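/- Let $\mathbb S=\mathbb R/\mathbb Z$ with its arc-length metric $d$ and Lebesgue measure $\mathfrak m$, and let $(\Omega,\mathcal F,\eta)$ be a probability space. For each $\omega\in\Omega$ let $T_\omega:\mathbb S\to\mathbb S$ be a $C^2$ map without critical points, such that $(\omega,x)\mapsto T_\omega x$ is measurable, and suppose that $$\int_\Omega \lambda_\omega^{-2}\,d\eta(\omega)<1\quad\text{and}\quad \int_\Omega\Delta_\omega^2\,d\eta(\omega)<\infty,\qquad\text{where } \lambda_\omega=\inf|T_\omega'|,\quad \Delta_\omega=\left\|\frac{T_\omega''}{(T_\omega')^2}\right\|_\infty .$$ For $\omega=(\omega_i)_{i\ge1}\in\Omega^{\mathbb N}$ and $x\in\mathbb S$ put $X_0(\omega,x)=x$ and $X_n(\omega,x)=T_{\omega_n}\circ\cdots\circ T_{\omega_1}(x)$. A probability measure $\mu$ on $\mathbb S$ is called stationary if $\int\!\int_\Omega f(T_{\omega}x)\,d\eta(\omega)\,d\mu(x)=\int f\,d\mu$ for all bounded measurable $f:\mathbb S\to\mathbb R$. Write $E^\mu$ for the expectation with respect to $\eta^{\otimes\mathbb N}\otimes\mu$ on $\Omega^{\mathbb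 N}\times\mathbb S$. There exists a stationary probability measure $\mu$ that has a Lipschitz continuous density with respect to $\mathfrak m$ bounded away from zero, and for any such $\mu$ the following holds. There exist a constant $\theta\in(0,1)$ and, given $\alpha\in(0,1)$, $H>0$ and $\varepsilon>0$, a constant $C>0$ such that $$\bigl|E^\mu[FG_n]-E^\mu[F]\,E^\mu[G_n]\bigr|\le C\theta^{\alpha n}$$ for all integers $m,k,n\ge0$, all functions $f_j:\mathbb S\to\mathbb R$, $j\ge0$, with $|f_j(x)-f_j(y)|\le H\,d(x,y)^\alpha$ for all $x,y\in\mathbb S$, and all real numbers $t_j$, $j\ge0$, with $|t_j|\le\varepsilon$, where $g_j=e^{it_jf_j}$ and $$F=\prod_{j=0}^{m} g_j\circ X_j,\qquad G_n=\prod_{j=m+1}^{m+k} g_j\circ X_{j+n}$$ (the empty product being $1$). In particular $\theta$ does not depend on $\alpha,H,\varepsilon$, and $C$ does not depend on $m,k,n,(f_j),(t_j)$. -/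

import Mathlib

open MeasureTheory

noncomputable section

namespace RandomCircle

/-- The representative in `[-1/2, 1/2)` of a point of the circle `ℝ / ℤ`. -/
def centeredRep (y : UnitAddCircle) : ℝ := (AddCircle.equivIco (1 : ℝ) (-1 / 2) y : ℝ)

/-- The derivative `T' : 𝕊 → ℝ` of a circle map: the derivative at `h = 0` of the signed
displacement `T (x + h) - T x`. If `G : ℝ → ℝ` is a differentiable lift of `T`, it is
`T' (x mod 1) = G' x`; see `circleDeriv_coe`. -/
def circleDeriv (T : UnitAddCircle → UnitAddCircle) (x : UnitAddCircle) : ℝ :=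
  deriv (fun h : ℝ => centeredRep (T (x + (h : UnitAddCircle)) - T x)) 0

/-- The second derivative `T'' : 𝕊 → ℝ`: the derivative of the real function `T'` on the circle. -/
def circleDeriv₂ (T : UnitAddCircle → UnitAddCircle) (x : UnitAddCircle) : ℝ :=
  deriv (fun h : ℝ => circleDeriv T (x + (h : UnitAddCircle))) 0

/-- `T : 𝕊 → 𝕊` is of class `C²` (it has a `C²` lift to the real line) and has no critical
points. -/
structure IsC2NonCritical (T : UnitAddCircle → UnitAddCircle) : Prop where
  exists_lift : ∃ G : ℝ → ℝ, ContDiff ℝ 2 G ∧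
    ∀ x : ℝ, T (x : UnitAddCircle) = ((G x : ℝ) : UnitAddCircle)
  deriv_ne_zero : ∀ x, circleDeriv T x ≠ 0

/-- The dilation `λ = inf |T'|`. -/
def dilation (T : UnitAddCircle → UnitAddCircle) : ℝ := ⨅ x, |circleDeriv T x|

/-- The distortion `Δ = ‖T'' / (T')²‖_∞`. -/
def distortion (T : UnitAddCircle → UnitAddCircle) : ℝ :=
  ⨆ x, |circleDeriv₂ T x / circleDeriv T x ^ 2|

section Chain

variable {Ω : Type*}

/-- `chain T n ω x = X_n(ω, x) = T_{ω_n} ∘ ⋯ ∘ T_{ω_1} (x)`; the entry `ω i` of the sequence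
`ω : ℕ → Ω` stands for `ω_{i+1}`. -/
def chain (T : Ω → UnitAddCircle → UnitAddCircle) :
    ℕ → (ℕ → Ω) → UnitAddCircle → UnitAddCircle
  | 0, _, x => x
  | n + 1, ω, x => T (ω n) (chain T n ω x)

variable [MeasurableSpace Ω]

/-- The Markov operator `𝒬 f (x) = ∫ f (T_ω x) dη(ω)`. -/
def markovOp (η : Measure Ω) (T : Ω → UnitAddCircle → UnitAddCircle) (f : UnitAddCircle → ℝ)
    (x : UnitAddCircle) : ℝ :=
  ∫ ω, f (T ω x) ∂η

/-- `μ` is stationary for the Markov chain: `∫ 𝒬 f dμ = ∫ f dμ` for all bounded measurable `f`. -/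
def IsStationary (η : Measure Ω) (T : Ω → UnitAddCircle → UnitAddCircle)
    (μ : Measure UnitAddCircle) : Prop :=
  ∀ f : UnitAddCircle → ℝ, Measurable f → (∃ B, ∀ x, |f x| ≤ B) →
    ∫ x, markovOp η T f x ∂μ = ∫ x, f x ∂μ

/-- `μ` is an absolutely continuous stationary probability distribution whose density with respect
to Lebesgue measure is Lipschitz continuous and bounded away from zero. -/
structure IsRegularStationary (η : Measure Ω) (T : Ω → UnitAddCircle → UnitAddCircle)
    (μ : Measure UnitAddCircle) : Prop where
  isProbabilityMeasure : IsProbabilityMeasure μ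
  stationary : IsStationary η T μ
  density : ∃ φ : UnitAddCircle → ℝ, (∃ K, LipschitzWith K φ) ∧ (∃ c > 0, ∀ x, c ≤ φ x) ∧
    μ = (volume : Measure UnitAddCircle).withDensity (fun x => ENNReal.ofReal (φ x))

/-- The expectation `E^μ`: the integral over the noise `ω`, distributed according to the product
measure `η^∞`, and over the initial point `x`, distributed according to `μ`. -/
def expect (η : Measure Ω) [IsProbabilityMeasure η] (μ : Measure UnitAddCircle)
    (Z : (ℕ → Ω) → UnitAddCircle → ℂ) : ℂ :=
  ∫ p, Z p.1 p.2 ∂((Measure.infinitePi (fun _ : ℕ => η)).prod μ)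

/-- `g_k = e^{i t_k f_k}`. -/
def phase (f : ℕ → UnitAddCircle → ℝ) (t : ℕ → ℝ) (k : ℕ) (x : UnitAddCircle) : ℂ :=
  Complex.exp (Complex.I * (t k : ℂ) * (f k x : ℂ))

/-- `F = g_0 ∘ X_0 ⋯ g_m ∘ X_m`. -/
def initialBlock (T : Ω → UnitAddCircle → UnitAddCircle) (g : ℕ → UnitAddCircle → ℂ) (m : ℕ)
    (ω : ℕ → Ω) (x : UnitAddCircle) : ℂ :=
  ∏ j ∈ Finset.Icc 0 m, g j (chain T j ω x)

/-- `G_n = g_{m+1} ∘ X_{m+1+n} ⋯ g_{m+k} ∘ X_{m+k+n}`. -/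
def laterBlock (T : Ω → UnitAddCircle → UnitAddCircle) (g : ℕ → UnitAddCircle → ℂ) (m k n : ℕ)
    (ω : ℕ → Ω) (x : UnitAddCircle) : ℂ :=
  ∏ j ∈ Finset.Icc (m + 1) (m + k), g j (chain T (j + n) ω x)

end Chain

theorem centeredRep_coe {y : ℝ} (hy : y ∈ Set.Ico (-1 / 2 : ℝ) (-1 / 2 + 1)) :
    centeredRep (y : UnitAddCircle) = y := by
  have h := AddCircle.equivIco_coe_eq (p := (1 : ℝ)) (a := -1 / 2) hy
  simp only [centeredRep]
  rw [h]

/-- The derivative of a circle map is the derivative of any lift. -/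
theorem circleDeriv_coe {T : UnitAddCircle → UnitAddCircle} {G : ℝ → ℝ}
    (hT : ∀ x : ℝ, T (x : UnitAddCircle) = ((G x : ℝ) : UnitAddCircle)) {x : ℝ}
    (hG : DifferentiableAt ℝ G x) : circleDeriv T (x : UnitAddCircle) = deriv G x := by
  have hc : Filter.Tendsto (fun h : ℝ => G (x + h) - G x) (nhds 0) (nhds 0) := by
    have h1 : ContinuousAt (fun h : ℝ => G (x + h) - G x) 0 := by
      have h2 : ContinuousAt G (x + 0) := by simpa using hG.continuousAt
      have h3 : ContinuousAt (fun h : ℝ => x + h) 0 := by fun_prop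
      exact (ContinuousAt.comp (f := fun h : ℝ => x + h) h2 h3).sub continuousAt_const
    simpa [ContinuousAt] using h1
  have hev : (fun h : ℝ => centeredRep (T ((x : UnitAddCircle) + (h : UnitAddCircle))
      - T (x : UnitAddCircle))) =ᶠ[nhds 0] fun h => G (x + h) - G x := by
    have hn : Set.Ioo (-1 / 2 : ℝ) (1 / 2) ∈ nhds (0 : ℝ) := Ioo_mem_nhds (by norm_num) (by norm_num)
    filter_upwards [hc hn] with h hh
    rw [← AddCircle.coe_add, hT, hT, ← AddCircle.coe_sub]
    have hh' : -1 / 2 < G (x + h) - G x ∧ G (x + h) - G x < 1 / 2 := hh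
    exact centeredRep_coe ⟨hh'.1.le, by linarith [hh'.2]⟩
  rw [circleDeriv, hev.deriv_eq, deriv_sub_const, deriv_comp_const_add, add_zero]

end RandomCircle

end

open RandomCircle

namespace RandomCircle

open Filter Topology Set

/-! The transfer operator of `T ω`, averaged over `ω`, is an operator `P` dual to the Markov
operator. Let `φ` be the stationary density, a fixed point of `P`. Let `f` be obtained from `φ` by
alternately multiplying by `g_j` and applying `P`, for `j = 0, …, m`, and let `Ψ` be the expectation
of the later product as a function of its starting point, so `|Ψ| ≤ 1`. Duality gives `E[F G_n] = ∫
Ψ · Pⁿ f`, `E[F] = ∫ f` and `E[G_n] = ∫ Ψ φ`. The correlation is thus at most the `L¹` norm of `Pⁿ f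
- (∫ f) φ`, and two facts are needed: Hölder bounds on `f` uniform in `m`
(`exists_mixture_weightedEvolution`), and exponential `L¹` convergence for Hölder data at a rate `θ
^ (α n)` (`exists_decay_complex`).

For the first fact, expansion holds only on average, so averaging is postponed. The pair `(f, φ)` is
kept as a `Mixture` of pairs `(F s, ρ s)`, where `ρ s` is a probability density with `log ρ s` being
`b s`-Lipschitz, and `F s` is dominated by `ρ s` and `α`-Hölder relative to it with constant `a s`.
A map with dilation `λ` and distortion `Δ` turns `b` into `λ⁻¹ b + Δ`; multiplication by a
`K`-Hölder `g` with `|g| ≤ 1`, followed by the map, turns `a` into `λ^(-α) (a + K) + Δ`. The new map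
is independent of the component `s`, and `λ⁻¹` and `λ^(-α)` have second moments below one, so the
second moments of `a` and `b` contract up to an additive constant (`exists_mixture_step`). Second
moments are what is needed: a log-Lipschitz density is at most `2 (1 + b)`, so its Lipschitz
constant is quadratic in `b`. The mixture also bounds the averaged density from below.

For the second fact, regular densities acquire after `N` steps a common lower bound and Lipschitz
bound. Removing a constant `κ` and renormalizing leaves densities of the same regularity class, so
differences contract by `1 - κ` (`exists_coupling`). This yields the invariant density and
exponential decay for Lipschitz data. Hölder data are approximated by Lipschitz functions at an
exponentially small scale, which produces the factor `α` in the exponent and a `θ` independent of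
`α`. -/

/-- The transfer operator `f ↦ ∑_{T y = x} f y / |T' y|` of a circle map. -/
noncomputable def transfer {E : Type*} [NormedAddCommGroup E] [NormedSpace ℝ E]
    (T : UnitAddCircle → UnitAddCircle) (f : UnitAddCircle → E) (x : UnitAddCircle) : E :=
  ∑ᶠ y ∈ T ⁻¹' {x}, |circleDeriv T y|⁻¹ • f y

/-! ### The circle as a quotient of the line -/

theorem continuous_of_comp_coe {X : Type*} [TopologicalSpace X] {f : UnitAddCircle → X}
    (h : Continuous fun x : ℝ => f (x : UnitAddCircle)) : Continuous f :=
  (QuotientAddGroup.isQuotientMap_mk (AddSubgroup.zmultiples (1 : ℝ))).continuous_iff.2 h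

theorem norm_coe_le_abs (x : ℝ) : ‖(x : UnitAddCircle)‖ ≤ |x| := by
  rw [UnitAddCircle.norm_eq]
  simpa using round_le x 0

theorem dist_coe_coe_le (x y : ℝ) : dist (x : UnitAddCircle) (y : UnitAddCircle) ≤ |x - y| := by
  rw [dist_eq_norm, ← AddCircle.coe_sub]
  exact norm_coe_le_abs _

theorem coe_int_eq_zero (k : ℤ) : ((k : ℝ) : UnitAddCircle) = 0 :=
  (AddCircle.coe_eq_zero_iff (1 : ℝ)).2 ⟨k, by simp⟩

theorem coe_eq_coe_iff {x y : ℝ} :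
    (x : UnitAddCircle) = (y : UnitAddCircle) ↔ ∃ k : ℤ, x = y + k := by
  rw [← sub_eq_zero, ← AddCircle.coe_sub, AddCircle.coe_eq_zero_iff]
  constructor
  · rintro ⟨k, hk⟩
    exact ⟨k, by simp at hk; linarith⟩
  · rintro ⟨k, hk⟩
    exact ⟨k, by simp [hk]⟩

theorem exists_coe_eq (x : UnitAddCircle) : ∃ a : ℝ, (a : UnitAddCircle) = x :=
  QuotientAddGroup.mk_surjective x

theorem exists_coe_eq_dist (x y : UnitAddCircle) :
    ∃ a b : ℝ, (a : UnitAddCircle) = x ∧ (b : UnitAddCircle) = y ∧ |a - b| = dist x y := by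
  obtain ⟨a, rfl⟩ := exists_coe_eq x
  obtain ⟨b, rfl⟩ := exists_coe_eq y
  refine ⟨a - round (a - b), b, ?_, rfl, ?_⟩
  · rw [AddCircle.coe_sub, coe_int_eq_zero, sub_zero]
  · rw [dist_eq_norm, ← AddCircle.coe_sub, UnitAddCircle.norm_eq]
    congr 1
    ring

theorem dist_le_half (x y : UnitAddCircle) : dist x y ≤ 1 / 2 := by
  obtain ⟨a, b, rfl, rfl, h⟩ := exists_coe_eq_dist x y
  rw [dist_eq_norm, ← AddCircle.coe_sub, UnitAddCircle.norm_eq]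
  exact abs_sub_round _

/-! ### Lifts, inverse branches and distortion of a single map -/

section SingleMap

variable {T : UnitAddCircle → UnitAddCircle}

theorem circleDeriv₂_coe {G : ℝ → ℝ} (hG : ContDiff ℝ 2 G)
    (hTG : ∀ x : ℝ, T (x : UnitAddCircle) = ((G x : ℝ) : UnitAddCircle)) (x : ℝ) :
    circleDeriv₂ T (x : UnitAddCircle) = deriv (deriv G) x := by
  have h : (fun h : ℝ => circleDeriv T ((x : UnitAddCircle) + (h : UnitAddCircle)))
      = fun h => deriv G (x + h) := by
    funext h
    rw [← AddCircle.coe_add, circleDeriv_coe hTG (hG.differentiable (by norm_num) _)]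
  rw [circleDeriv₂, h, deriv_comp_const_add, add_zero]

theorem IsC2NonCritical.continuous (hT : IsC2NonCritical T) : Continuous T := by
  obtain ⟨G, hG, hTG⟩ := hT.exists_lift
  refine continuous_of_comp_coe ?_
  simp_rw [hTG]
  exact (AddCircle.continuous_mk' 1).comp hG.continuous

theorem IsC2NonCritical.continuous_circleDeriv (hT : IsC2NonCritical T) :
    Continuous (circleDeriv T) := by
  obtain ⟨G, hG, hTG⟩ := hT.exists_lift
  refine continuous_of_comp_coe ?_
  have : (fun x : ℝ => circleDeriv T (x : UnitAddCircle)) = deriv G :=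
    funext fun x => circleDeriv_coe hTG (hG.differentiable (by norm_num) _)
  rw [this]
  exact hG.continuous_deriv (by norm_num)

theorem IsC2NonCritical.continuous_circleDeriv₂ (hT : IsC2NonCritical T) :
    Continuous (circleDeriv₂ T) := by
  obtain ⟨G, hG, hTG⟩ := hT.exists_lift
  refine continuous_of_comp_coe ?_
  have : (fun x : ℝ => circleDeriv₂ T (x : UnitAddCircle)) = deriv (deriv G) :=
    funext fun x => circleDeriv₂_coe hG hTG x
  rw [this]
  have h1 : ContDiff ℝ 1 (deriv G) := ContDiff.deriv' hG
  exact h1.continuous_deriv (by norm_num)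

theorem dilation_le (T : UnitAddCircle → UnitAddCircle) (x : UnitAddCircle) :
    dilation T ≤ |circleDeriv T x| :=
  ciInf_le ⟨0, by rintro _ ⟨y, rfl⟩; positivity⟩ x

theorem IsC2NonCritical.dilation_pos (hT : IsC2NonCritical T) : 0 < dilation T := by
  obtain ⟨x, hx⟩ := (hT.continuous_circleDeriv.abs).exists_forall_le_of_hasCompactMulSupport
    (HasCompactMulSupport.of_compactSpace _)
  exact (abs_pos.2 (hT.deriv_ne_zero x)).trans_le (le_ciInf hx)

theorem IsC2NonCritical.continuous_distortion_quotient (hT : IsC2NonCritical T) :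
    Continuous fun x => |circleDeriv₂ T x / circleDeriv T x ^ 2| :=
  (hT.continuous_circleDeriv₂.div (hT.continuous_circleDeriv.pow 2)
    fun x => pow_ne_zero 2 (hT.deriv_ne_zero x)).abs

theorem IsC2NonCritical.le_distortion (hT : IsC2NonCritical T) (x : UnitAddCircle) :
    |circleDeriv₂ T x / circleDeriv T x ^ 2| ≤ distortion T :=
  le_ciSup (isCompact_range hT.continuous_distortion_quotient).bddAbove x

theorem distortion_nonneg (T : UnitAddCircle → UnitAddCircle) : 0 ≤ distortion T :=
  Real.iSup_nonneg fun _ => abs_nonneg _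

/-- A `C²` lift of a circle map together with its inverse and its degree. -/
structure InverseLift (T : UnitAddCircle → UnitAddCircle) (G S : ℝ → ℝ) (e : ℤ) : Prop where
  contDiff : ContDiff ℝ 2 G
  coe_eq : ∀ x : ℝ, T (x : UnitAddCircle) = ((G x : ℝ) : UnitAddCircle)
  degree_ne_zero : e ≠ 0
  right_inv : ∀ x, G (S x) = x
  left_inv : ∀ x, S (G x) = x
  add_int : ∀ (x : ℝ) (k : ℤ), G (x + k) = G x + k * e
  hasDerivAt_inv : ∀ x, HasDerivAt S (deriv G (S x))⁻¹ x

/-- A lift has no critical point, so it is injective by Rolle. The increment over one period is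
constant because `T'` is periodic, and it is an integer `e`, nonzero by injectivity. The resulting
unbounded growth in both directions gives surjectivity. -/
theorem IsC2NonCritical.exists_inverseLift (hT : IsC2NonCritical T) :
    ∃ (G S : ℝ → ℝ) (e : ℤ), InverseLift T G S e := by
  obtain ⟨G, hG, hTG⟩ := hT.exists_lift
  have hd : Differentiable ℝ G := hG.differentiable (by norm_num)
  have hcd : ∀ x : ℝ, circleDeriv T (x : UnitAddCircle) = deriv G x := fun x =>
    circleDeriv_coe hTG (hd x)
  have hne : ∀ x, deriv G x ≠ 0 := fun x => hcd x ▸ hT.deriv_ne_zero _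
  have hinj : Function.Injective G := by
    intro a b hab
    by_contra hne'
    rcases lt_or_gt_of_ne hne' with h | h
    · obtain ⟨c, -, hc⟩ := exists_deriv_eq_zero h hG.continuous.continuousOn hab
      exact hne c hc
    · obtain ⟨c, -, hc⟩ := exists_deriv_eq_zero h hG.continuous.continuousOn hab.symm
      exact hne c hc
  obtain ⟨e, he⟩ : ∃ e : ℤ, G (0 + 1) = G 0 + e := by
    refine coe_eq_coe_iff.1 ?_
    rw [← hTG, ← hTG]
    congr 1
    exact coe_eq_coe_iff.2 ⟨1, by simp⟩
  have hone : ∀ x, G (x + 1) = G x + e := by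
    have hd' : Differentiable ℝ fun x => G (x + 1) :=
      hd.comp (differentiable_id.add_const 1)
    have hdiff : Differentiable ℝ fun x => G (x + 1) - G x := hd'.sub hd
    intro x
    have h := is_const_of_deriv_eq_zero hdiff (fun x => by
      rw [deriv_fun_sub (hd' x) (hd x), deriv_comp_add_const,
        ← hcd, ← hcd, sub_eq_zero]
      congr 1
      exact coe_eq_coe_iff.2 ⟨1, by simp⟩) x 0
    linarith
  have hint : ∀ (x : ℝ) (k : ℤ), G (x + k) = G x + k * e := by
    intro x k
    induction k using Int.induction_on with
    | zero => simp
    | succ n ih =>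
      have := hone (x + (n : ℤ))
      push_cast at *
      rw [← add_assoc, this, ih]
      ring
    | pred n ih =>
      have := hone (x + (-(n : ℤ) - 1 : ℤ))
      push_cast at *
      rw [show x + (-(n : ℝ) - 1) + 1 = x + -(n : ℝ) by ring, ih] at this
      linarith
  have he0 : e ≠ 0 := by
    rintro rfl
    have : (0 : ℝ) + 1 = 0 := hinj (by simpa using he)
    norm_num at this
  have he1 : (1 : ℝ) ≤ (e : ℝ) ^ 2 := by
    have : 1 ≤ e ^ 2 := Int.one_le_abs (pow_ne_zero 2 he0) |>.trans_eq (abs_of_nonneg (sq_nonneg e))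
    exact_mod_cast this
  have hsurj : Function.Surjective G := by
    intro y
    -- Evaluating at multiples of `e` makes the increments `k * e²`, so the sign of `e` plays no
    -- role.
    have key : ∀ k : ℤ, G (0 + (k * e : ℤ)) = G 0 + k * (e : ℝ) ^ 2 := by
      intro k
      rw [hint]
      push_cast
      ring
    have hnn : (0 : ℝ) ≤ ⌈|y - G 0|⌉₊ := by positivity
    have hle := Nat.le_ceil |y - G 0|
    have h1 := le_abs_self (y - G 0)
    have h2 := neg_abs_le (y - G 0)
    refine mem_range_of_exists_le_of_exists_ge hG.continuous
      ⟨_, (key (-(⌈|y - G 0|⌉₊ : ℤ))).le.trans ?_⟩ ⟨_, le_trans ?_ (key (⌈|y - G 0|⌉₊ : ℤ)).ge⟩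
    · push_cast
      nlinarith
    · push_cast
      nlinarith
  let Φ : ℝ ≃ₜ ℝ := (Equiv.ofBijective G ⟨hinj, hsurj⟩).toHomeomorphOfContinuousOpen hG.continuous
    (isOpenMap_of_hasStrictDerivAt
      (fun x => hG.contDiffAt.hasStrictDerivAt (by norm_num)) hne)
  have hr : ∀ x, G (Φ.symm x) = x := fun x => Φ.apply_symm_apply x
  exact ⟨G, Φ.symm, e, hG, hTG, he0, hr, fun x => Φ.symm_apply_apply x, hint, fun x =>
    HasDerivAt.of_local_left_inverse Φ.symm.continuous.continuousAt (hd _).hasDerivAt (hne _)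
      (Eventually.of_forall hr)⟩

namespace InverseLift

variable {G S : ℝ → ℝ} {e : ℤ}

theorem circleDeriv_eq (h : InverseLift T G S e) (x : ℝ) :
    circleDeriv T (x : UnitAddCircle) = deriv G x :=
  circleDeriv_coe h.coe_eq (h.contDiff.differentiable (by norm_num) _)

theorem inv_add (h : InverseLift T G S e) (x : ℝ) (k : ℤ) : S (x + k * e) = S x + k := by
  rw [← h.left_inv (S x + k), h.add_int, h.right_inv]

/-- Translating the argument of `S` by a multiple of `e` changes the value by an integer, so only
the residues modulo `e` give distinct points of the fibre. -/
theorem preimage_singleton (h : InverseLift T G S e) (x : ℝ) :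
    T ⁻¹' {(x : UnitAddCircle)} = (fun j : ℕ => ((S (x + j) : ℝ) : UnitAddCircle)) ''
      (Finset.range e.natAbs : Set ℕ) := by
  have he := h.degree_ne_zero
  ext y
  constructor
  · intro hy
    obtain ⟨a, rfl⟩ := exists_coe_eq y
    have hy' : T (a : UnitAddCircle) = (x : UnitAddCircle) := hy
    rw [h.coe_eq, coe_eq_coe_iff] at hy'
    obtain ⟨l, hl⟩ := hy'
    have h0 := Int.emod_nonneg l he
    have h1 := Int.emod_lt_abs l he
    have h2 := Int.emod_add_mul_ediv l e
    obtain ⟨j, hj⟩ := Int.eq_ofNat_of_zero_le h0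
    refine ⟨j, ?_, ?_⟩
    · simp only [Finset.coe_range, mem_Iio]
      rw [Int.abs_eq_natAbs] at h1
      omega
    · refine coe_eq_coe_iff.2 ⟨-(l / e), ?_⟩
      have h3 : (l : ℝ) = j + e * (l / e : ℤ) := by
        rw [hj] at h2
        exact_mod_cast h2.symm
      have h4 := h.inv_add (x + j) (l / e)
      rw [show x + (j : ℝ) + (l / e : ℤ) * e = G a by rw [hl, h3]; ring, h.left_inv] at h4
      push_cast
      linarith
  · rintro ⟨j, -, rfl⟩
    change T _ = _
    rw [h.coe_eq, h.right_inv]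
    exact coe_eq_coe_iff.2 ⟨j, by simp⟩

theorem injOn_fiber (h : InverseLift T G S e) (x : ℝ) :
    InjOn (fun j : ℕ => ((S (x + j) : ℝ) : UnitAddCircle)) (Finset.range e.natAbs : Set ℕ) := by
  intro i hi j hj hij
  simp only [Finset.coe_range, mem_Iio] at hi hj
  obtain ⟨k, hk⟩ := coe_eq_coe_iff.1 hij
  have h1 : x + i = x + j + k * e := by
    rw [← h.right_inv (x + i), hk, h.add_int, h.right_inv]
  have h2 : (i : ℤ) = j + k * e := by
    have : (i : ℝ) = j + k * e := by linarith
    exact_mod_cast this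
  have h3 : (i : ℤ) - j = 0 := by
    refine Int.eq_zero_of_abs_lt_dvd (m := |e|) ((abs_dvd _ _).2 ⟨k, by linarith⟩) ?_
    rw [Int.abs_eq_natAbs e, abs_lt]
    omega
  omega

theorem transfer_eq {E : Type*} [NormedAddCommGroup E] [NormedSpace ℝ E]
    (h : InverseLift T G S e) (f : UnitAddCircle → E) (x : ℝ) :
    transfer T f (x : UnitAddCircle) = ∑ j ∈ Finset.range e.natAbs,
      |(deriv G (S (x + j)))⁻¹| • f ((S (x + j) : ℝ) : UnitAddCircle) := by
  rw [transfer, h.preimage_singleton, finsum_mem_image (h.injOn_fiber x), finsum_mem_coe_finset]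
  simp_rw [h.circleDeriv_eq, abs_inv]

/-- The inverse lift carries an interval of length `|e|` onto one period. If `S` decreases, the
included endpoint changes sides, hence the equality only almost everywhere. -/
theorem image_Ioc_ae_eq (h : InverseLift T G S e) :
    ∃ t : ℝ, (S '' Ioc 0 (e.natAbs : ℝ) : Set ℝ) =ᵐ[volume] (Ioc t (t + 1) : Set ℝ) := by
  have himg : S '' Ioc 0 (e.natAbs : ℝ) = G ⁻¹' Ioc 0 (e.natAbs : ℝ) := by
    ext u
    constructor
    · rintro ⟨x, hx, rfl⟩
      simpa [h.right_inv] using hx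
    · intro hu
      exact ⟨G u, hu, h.left_inv u⟩
  have hadd := h.add_int 0 1
  have habs : (e.natAbs : ℝ) = |(e : ℝ)| := by
    rw [Nat.cast_natAbs]
    push_cast
    rfl
  have hinv := h.inv_add 0
  rw [himg]
  rcases h.contDiff.continuous.strictMono_of_inj (Function.LeftInverse.injective h.left_inv)
    with hm | hm
  · have hpos : (0 : ℝ) ≤ e := by
      have := hm (show (0 : ℝ) < 0 + (1 : ℤ) by norm_num)
      push_cast at *
      linarith
    refine ⟨S 0, Eq.eventuallyEq (Set.ext fun u => ?_)⟩
    have h1 := hinv 1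
    rw [habs, abs_of_nonneg hpos]
    have h2 : G (S 0 + 1) = e := by
      have : S 0 + 1 = S (0 + (1 : ℤ) * e) := by rw [h1]; simp
      rw [this, h.right_inv]
      simp
    rw [mem_preimage, mem_Ioc, mem_Ioc, ← hm.lt_iff_lt (a := S 0), h.right_inv,
      ← hm.le_iff_le (a := u), h2]
  · have hneg : (e : ℝ) ≤ 0 := by
      have := hm (show (0 : ℝ) < 0 + (1 : ℤ) by norm_num)
      push_cast at *
      linarith
    refine ⟨S 0 - 1, EventuallyEq.trans (Eq.eventuallyEq (Set.ext fun u => ?_))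
      Ico_ae_eq_Ioc⟩
    have h1 := hinv (-1)
    rw [habs, abs_of_nonpos hneg]
    have h2 : G (S 0 - 1) = -e := by
      have : S 0 - 1 = S (0 + (-1 : ℤ) * e) := by rw [h1]; simp; ring
      rw [this, h.right_inv]
      simp
    rw [mem_preimage, mem_Ioc, mem_Ico, sub_add_cancel, ← hm.lt_iff_gt (a := S 0), h.right_inv,
      ← hm.le_iff_ge (b := S 0 - 1), h2, and_comm]

/-- Integrating the `|e|` branches over one period unfolds to a single integral over an interval of
length `|e|`; the substitution by `S` turns it into the integral of `f` over one period. -/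
theorem integral_transfer {E : Type*} [NormedAddCommGroup E] [NormedSpace ℝ E]
    (h : InverseLift T G S e) {f : UnitAddCircle → E} (hf : Integrable f) :
    ∫ x, transfer T f x = ∫ x, f x := by
  set φ : ℝ → E := fun y => |(deriv G (S y))⁻¹| • f ((S y : ℝ) : UnitAddCircle) with hφ
  have hSinj : Function.Injective S := Function.LeftInverse.injective h.right_inv
  obtain ⟨t, ht⟩ := h.image_Ioc_ae_eq
  have hmp := AddCircle.measurePreserving_mk (1 : ℝ) t
  have hint : IntegrableOn φ (Ioc 0 (e.natAbs : ℝ)) := by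
    rw [hφ, ← integrableOn_image_iff_integrableOn_abs_deriv_smul measurableSet_Ioc
      (fun x _ => (h.hasDerivAt_inv x).hasDerivWithinAt) hSinj.injOn
      (fun u => f ((u : ℝ) : UnitAddCircle)), integrableOn_congr_set_ae ht]
    exact hmp.integrable_comp_of_integrable hf
  have hii : ∀ j < e.natAbs, IntervalIntegrable φ volume (j : ℝ) ((j + 1 : ℕ) : ℝ) := by
    intro j hj
    rw [intervalIntegrable_iff_integrableOn_Ioc_of_le (by push_cast; linarith)]
    refine hint.mono_set (Ioc_subset_Ioc (by positivity) ?_)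
    exact_mod_cast hj
  have hleft : ∫ x, transfer T f x = ∫ y in Ioc 0 (e.natAbs : ℝ), φ y := by
    rw [← AddCircle.integral_preimage (1 : ℝ) 0]
    simp_rw [h.transfer_eq]
    rw [← intervalIntegral.integral_of_le (by norm_num), intervalIntegral.integral_finsetSum,
      ← intervalIntegral.integral_of_le (by positivity)]
    · have := intervalIntegral.sum_integral_adjacent_intervals (f := φ) (μ := volume)
        (a := fun j : ℕ => (j : ℝ)) (n := e.natAbs) hii
      simp only [Nat.cast_zero] at this
      rw [← this]
      refine Finset.sum_congr rfl fun j _ => ?_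
      have h2 := intervalIntegral.integral_comp_add_right (a := 0) (b := 0 + 1) φ (j : ℝ)
      rw [show (0 : ℝ) + j = j by ring, show (0 : ℝ) + 1 + j = ((j + 1 : ℕ) : ℝ) by
        push_cast; ring] at h2
      exact h2
    · intro j hj
      have h2 := (hii j (Finset.mem_range.1 hj)).comp_add_right (j : ℝ)
      rw [show (j : ℝ) - j = 0 by ring, show (((j + 1 : ℕ) : ℝ)) - j = 0 + 1 by
        push_cast; ring] at h2
      exact h2
  rw [hleft, hφ, ← integral_image_eq_integral_abs_deriv_smul measurableSet_Ioc
      (fun x _ => (h.hasDerivAt_inv x).hasDerivWithinAt) hSinj.injOn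
      (fun u => f ((u : ℝ) : UnitAddCircle)), setIntegral_congr_set ht,
    AddCircle.integral_preimage (1 : ℝ) t]

theorem abs_inv_sub_le (h : InverseLift T G S e) (hT : IsC2NonCritical T) (x y : ℝ) :
    |S x - S y| ≤ (dilation T)⁻¹ * |x - y| := by
  have := Convex.norm_image_sub_le_of_norm_hasDerivWithin_le (f := S) (s := univ)
    (f' := fun x => (deriv G (S x))⁻¹) (C := (dilation T)⁻¹)
    (fun x _ => (h.hasDerivAt_inv x).hasDerivWithinAt) (fun x _ => by
      rw [Real.norm_eq_abs, abs_inv, ← h.circleDeriv_eq]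
      exact inv_anti₀ hT.dilation_pos (dilation_le T _)) convex_univ (mem_univ y) (mem_univ x)
  simpa using this

/-- The derivative of `log |G' ∘ S|` is `G'' / (G')²` evaluated at `S`, which is bounded by the
distortion. -/
theorem weight_le (h : InverseLift T G S e) (hT : IsC2NonCritical T) (x y : ℝ) :
    |(deriv G (S x))⁻¹| ≤ Real.exp (distortion T * |x - y|) * |(deriv G (S y))⁻¹| := by
  have hne : ∀ x, deriv G x ≠ 0 := fun x => h.circleDeriv_eq x ▸ hT.deriv_ne_zero _
  have hd2 : Differentiable ℝ (deriv G) :=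
    (ContDiff.deriv' (n := 1) h.contDiff).differentiable (by norm_num)
  have hder : ∀ x, HasDerivAt (fun x => Real.log (deriv G (S x)))
      (deriv (deriv G) (S x) / deriv G (S x) ^ 2) x := by
    intro x
    have h1 := ((hd2 (S x)).hasDerivAt.comp x (h.hasDerivAt_inv x)).log (hne _)
    have h2 := hne (S x)
    refine h1.congr_deriv ?_
    rw [Function.comp_apply]
    field_simp
  have key := Convex.norm_image_sub_le_of_norm_hasDerivWithin_le (s := univ)
    (f := fun x => Real.log (deriv G (S x))) (C := distortion T)
    (fun x _ => (hder x).hasDerivWithinAt) (fun x _ => by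
      rw [Real.norm_eq_abs, ← h.circleDeriv_eq, ← circleDeriv₂_coe h.contDiff h.coe_eq]
      exact hT.le_distortion _) convex_univ (mem_univ x) (mem_univ y)
  simp only [Real.norm_eq_abs] at key
  have hpx : 0 < |(deriv G (S x))⁻¹| := abs_pos.2 (inv_ne_zero (hne _))
  have hpy : 0 < |(deriv G (S y))⁻¹| := abs_pos.2 (inv_ne_zero (hne _))
  rw [← Real.log_le_log_iff hpx (by positivity), Real.log_mul (by positivity) hpy.ne',
    Real.log_exp, Real.log_abs, Real.log_abs, Real.log_inv, Real.log_inv]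
  rw [abs_sub_comm x y]
  linarith [(abs_le.1 key).2]

end InverseLift

/-- The preimages of two points under `T` can be matched so that distances contract by the
dilation and weights are comparable up to the distortion. -/
theorem IsC2NonCritical.exists_matching (hT : IsC2NonCritical T) (x y : UnitAddCircle) :
    ∃ (d : ℕ) (p q : ℕ → UnitAddCircle) (v w : ℕ → ℝ),
      (∀ j, T (p j) = x) ∧ (∀ j, 0 ≤ v j) ∧ (∀ j, 0 ≤ w j) ∧
      (∀ j, dist (p j) (q j) ≤ (dilation T)⁻¹ * dist x y) ∧
      (∀ j, v j ≤ Real.exp (distortion T * dist x y) * w j) ∧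
      (∀ j, w j ≤ Real.exp (distortion T * dist x y) * v j) ∧
      (∀ (E : Type) [NormedAddCommGroup E] [NormedSpace ℝ E] (f : UnitAddCircle → E),
        transfer T f x = ∑ j ∈ Finset.range d, v j • f (p j)) ∧
      (∀ (E : Type) [NormedAddCommGroup E] [NormedSpace ℝ E] (f : UnitAddCircle → E),
        transfer T f y = ∑ j ∈ Finset.range d, w j • f (q j)) := by
  obtain ⟨G, S, e, h⟩ := hT.exists_inverseLift
  -- The representatives realize the circle distance, so estimates on the line transfer without
  -- loss.
  obtain ⟨a, b, rfl, rfl, hab⟩ := exists_coe_eq_dist x y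
  refine ⟨e.natAbs, fun j => ((S (a + j) : ℝ) : UnitAddCircle),
    fun j => ((S (b + j) : ℝ) : UnitAddCircle), fun j => |(deriv G (S (a + j)))⁻¹|,
    fun j => |(deriv G (S (b + j)))⁻¹|, fun j => ?_, fun j => abs_nonneg _, fun j => abs_nonneg _,
    fun j => ?_, fun j => ?_, fun j => ?_, fun E _ _ f => h.transfer_eq f a,
    fun E _ _ f => h.transfer_eq f b⟩
  · rw [h.coe_eq, h.right_inv]
    exact coe_eq_coe_iff.2 ⟨j, by simp⟩
  · refine (dist_coe_coe_le _ _).trans ((h.abs_inv_sub_le hT _ _).trans_eq ?_)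
    rw [← hab]
    simp
  · refine (h.weight_le hT _ (b + j)).trans_eq ?_
    rw [← hab]
    simp
  · refine (h.weight_le hT _ (a + j)).trans_eq ?_
    rw [← hab, abs_sub_comm a b]
    simp

end SingleMap

end RandomCircle

namespace RandomCircle

open Filter Topology Set

instance isProbabilityMeasure_volume : IsProbabilityMeasure (volume : Measure UnitAddCircle) :=
  ⟨UnitAddCircle.measure_univ⟩

/-! ### Algebraic properties of the transfer operator -/

section Transfer

variable {T : UnitAddCircle → UnitAddCircle}
  {E F : Type} [NormedAddCommGroup E] [NormedSpace ℝ E] [NormedAddCommGroup F] [NormedSpace ℝ F]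

theorem IsC2NonCritical.exists_transfer_eq_sum (hT : IsC2NonCritical T) (x : UnitAddCircle) :
    ∃ (d : ℕ) (p : ℕ → UnitAddCircle) (v : ℕ → ℝ), (∀ j, T (p j) = x) ∧ (∀ j, 0 ≤ v j) ∧
      ∀ (E : Type) [NormedAddCommGroup E] [NormedSpace ℝ E] (f : UnitAddCircle → E),
        transfer T f x = ∑ j ∈ Finset.range d, v j • f (p j) := by
  obtain ⟨d, p, -, v, -, hp, hv, -, -, -, -, h, -⟩ := hT.exists_matching x x
  exact ⟨d, p, v, hp, hv, h⟩

/-- The factor `ψ ∘ T` is constant on each fibre. Together with preservation of the integral this is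
the duality between transfer and composition. -/
theorem IsC2NonCritical.transfer_comp_smul {𝕜 : Type*} [RCLike 𝕜] [NormedSpace 𝕜 E]
    [SMulCommClass ℝ 𝕜 E] (hT : IsC2NonCritical T) (ψ : UnitAddCircle → 𝕜)
    (f : UnitAddCircle → E) (x : UnitAddCircle) :
    transfer T (fun y => ψ (T y) • f y) x = ψ x • transfer T f x := by
  obtain ⟨d, p, v, hp, hv, h⟩ := hT.exists_transfer_eq_sum x
  rw [h, h, Finset.smul_sum]
  exact Finset.sum_congr rfl fun j _ => by rw [hp, smul_comm]

theorem IsC2NonCritical.transfer_add (hT : IsC2NonCritical T) (f g : UnitAddCircle → E)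
    (x : UnitAddCircle) :
    transfer T (fun y => f y + g y) x = transfer T f x + transfer T g x := by
  obtain ⟨d, p, v, hp, hv, h⟩ := hT.exists_transfer_eq_sum x
  simp_rw [h, ← Finset.sum_add_distrib, smul_add]

theorem IsC2NonCritical.transfer_clm (hT : IsC2NonCritical T) (l : E →L[ℝ] F)
    (f : UnitAddCircle → E) (x : UnitAddCircle) :
    transfer T (fun y => l (f y)) x = l (transfer T f x) := by
  obtain ⟨d, p, v, hp, hv, h⟩ := hT.exists_transfer_eq_sum x
  simp_rw [h, map_sum, map_smul]

theorem IsC2NonCritical.norm_transfer_le (hT : IsC2NonCritical T) {f : UnitAddCircle → E}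
    {ρ : UnitAddCircle → ℝ} (hf : ∀ x, ‖f x‖ ≤ ρ x) (x : UnitAddCircle) :
    ‖transfer T f x‖ ≤ transfer T ρ x := by
  obtain ⟨d, p, v, hp, hv, h⟩ := hT.exists_transfer_eq_sum x
  rw [h, h]
  refine (norm_sum_le _ _).trans (Finset.sum_le_sum fun j _ => ?_)
  rw [norm_smul, Real.norm_of_nonneg (hv j), smul_eq_mul]
  exact mul_le_mul_of_nonneg_left (hf _) (hv j)

theorem IsC2NonCritical.transfer_nonneg (hT : IsC2NonCritical T) {ρ : UnitAddCircle → ℝ}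
    (hρ : ∀ x, 0 ≤ ρ x) (x : UnitAddCircle) : 0 ≤ transfer T ρ x := by
  obtain ⟨d, p, v, hp, hv, h⟩ := hT.exists_transfer_eq_sum x
  rw [h]
  exact Finset.sum_nonneg fun j _ => mul_nonneg (hv j) (hρ _)

theorem IsC2NonCritical.continuous_transfer (hT : IsC2NonCritical T) {f : UnitAddCircle → E}
    (hf : Continuous f) : Continuous (transfer T f) := by
  obtain ⟨G, S, e, h⟩ := hT.exists_inverseLift
  refine continuous_of_comp_coe ?_
  simp_rw [h.transfer_eq]
  have hS : Continuous S :=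
    continuous_iff_continuousAt.2 fun x => (h.hasDerivAt_inv x).continuousAt
  have hG : Continuous (deriv G) := h.contDiff.continuous_deriv (by norm_num)
  refine continuous_finsetSum _ fun j _ => ?_
  have hSj : Continuous fun x : ℝ => S (x + j) := hS.comp (continuous_id.add continuous_const)
  refine Continuous.smul ((hG.comp hSj).inv₀ fun x => ?_).abs
    (hf.comp ((AddCircle.continuous_mk' 1).comp hSj))
  simp only [Function.comp, ← h.circleDeriv_eq]
  exact hT.deriv_ne_zero _

theorem IsC2NonCritical.integral_transfer (hT : IsC2NonCritical T) {f : UnitAddCircle → E}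
    (hf : Integrable f) : ∫ x, transfer T f x = ∫ x, f x := by
  obtain ⟨G, S, e, h⟩ := hT.exists_inverseLift
  exact h.integral_transfer hf

end Transfer

/-! ### Log-Lipschitz densities and relative Hölder bounds -/

/-- The logarithm of `ρ` is Lipschitz continuous with constant `b`. -/
def LogLip (b : ℝ) (ρ : UnitAddCircle → ℝ) : Prop :=
  ∀ u v, ρ u ≤ Real.exp (b * dist u v) * ρ v

/-- The modulus of continuity of `f` is `α`-Hölder relative to the weight `ρ`. -/
def HolderBy (α a : ℝ) (f : UnitAddCircle → ℂ) (ρ : UnitAddCircle → ℝ) : Prop :=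
  ∀ u v, ‖f u - f v‖ ≤ a * dist u v ^ α * (ρ u + ρ v)

theorem continuous_of_dist_le_rpow {Y : Type*} [PseudoMetricSpace Y] {f : UnitAddCircle → Y}
    {α K : ℝ} (hα : 0 < α) (h : ∀ u v, dist (f u) (f v) ≤ K * dist u v ^ α) : Continuous f := by
  refine continuous_iff_continuousAt.2 fun x => tendsto_iff_dist_tendsto_zero.2 ?_
  have h1 : Tendsto (fun y => K * dist y x ^ α) (𝓝 x) (𝓝 (K * dist x x ^ α)) := by
    have : Continuous fun y => K * dist y x ^ α :=
      continuous_const.mul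
        ((continuous_id.dist continuous_const).rpow_const fun _ => Or.inr hα.le)
    exact this.tendsto x
  rw [dist_self, Real.zero_rpow hα.ne', mul_zero] at h1
  exact squeeze_zero (fun _ => dist_nonneg) (fun y => h y x) h1

/-- The estimate for one pair of matched branches. The smaller weight is put on `a - a'` and the
excess of the larger is bounded by `1 - e^(-s) ≤ s`, so the loss is linear in `s`. A factor `e^s`
would call for exponential moments of the distortion. -/
theorem norm_smul_sub_smul_le {E : Type*} [NormedAddCommGroup E] [NormedSpace ℝ E]
    {v w s c r r' : ℝ} {a a' : E} (hv : 0 ≤ v) (hw : 0 ≤ w) (hvw : v ≤ Real.exp s * w)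
    (hwv : w ≤ Real.exp s * v) (ha : ‖a‖ ≤ r) (ha' : ‖a'‖ ≤ r') (hc : 0 ≤ c) (hs : 0 ≤ s)
    (haa : ‖a - a'‖ ≤ c * (r + r')) :
    ‖v • a - w • a'‖ ≤ (c + s) * (v * r + w * r') := by
  have key : ∀ {v w : ℝ}, v ≤ Real.exp s * w → 0 ≤ v → v - w ≤ s * v := by
    intro v w h hv
    have h1 : Real.exp (-s) * v ≤ w := by
      calc Real.exp (-s) * v ≤ Real.exp (-s) * (Real.exp s * w) := by gcongr
        _ = w := by rw [← mul_assoc, ← Real.exp_add]; simp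
    have h2 := mul_le_mul_of_nonneg_right (Real.add_one_le_exp (-s)) hv
    linarith
  have hr : 0 ≤ r := (norm_nonneg _).trans ha
  have hr' : 0 ≤ r' := (norm_nonneg _).trans ha'
  rcases le_total w v with h | h
  · have h1 : v • a - w • a' = w • (a - a') + (v - w) • a := by
      rw [smul_sub, sub_smul]; abel
    have h2 := key hvw hv
    calc ‖v • a - w • a'‖ ≤ w * ‖a - a'‖ + (v - w) * ‖a‖ := by
          rw [h1]
          refine (norm_add_le _ _).trans ?_
          rw [norm_smul, norm_smul, Real.norm_of_nonneg hw, Real.norm_of_nonneg (sub_nonneg.2 h)]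
      _ ≤ w * (c * (r + r')) + s * v * r := by
          gcongr
      _ ≤ (c + s) * (v * r + w * r') := by
          have h3 : w * (c * r) ≤ v * (c * r) := by gcongr
          have h4 : 0 ≤ s * (w * r') := by positivity
          nlinarith
  · have h1 : v • a - w • a' = v • (a - a') + (v - w) • a' := by
      rw [smul_sub, sub_smul]; abel
    have h2 := key hwv hw
    calc ‖v • a - w • a'‖ ≤ v * ‖a - a'‖ + (w - v) * ‖a'‖ := by
          rw [h1]
          refine (norm_add_le _ _).trans ?_
          rw [norm_smul, norm_smul, Real.norm_of_nonneg hv, norm_sub_rev v w,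
            Real.norm_of_nonneg (sub_nonneg.2 h)]
      _ ≤ v * (c * (r + r')) + s * w * r' := by
          gcongr
      _ ≤ (c + s) * (v * r + w * r') := by
          have h3 : v * (c * r') ≤ w * (c * r') := by gcongr
          have h4 : 0 ≤ s * (v * r) := by positivity
          nlinarith

section LogLip

variable {T : UnitAddCircle → UnitAddCircle} {b : ℝ} {ρ : UnitAddCircle → ℝ}

/-- On matched branches the contraction of preimages contributes `λ⁻¹ b` and the ratio of weights
contributes the distortion. -/
theorem LogLip.transfer (hT : IsC2NonCritical T) (h : LogLip b ρ) (hb : 0 ≤ b)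
    (hρ : ∀ x, 0 ≤ ρ x) :
    LogLip ((dilation T)⁻¹ * b + distortion T) (RandomCircle.transfer T ρ) := by
  intro x y
  obtain ⟨d, p, q, v, w, -, hv, hw, hd, hvw, -, hx, hy⟩ := hT.exists_matching x y
  rw [hx, hy, Finset.mul_sum]
  refine Finset.sum_le_sum fun j _ => ?_
  calc v j * ρ (p j)
      ≤ (Real.exp (distortion T * dist x y) * w j) *
        (Real.exp (b * ((dilation T)⁻¹ * dist x y)) * ρ (q j)) := by
        have h1 := hw j
        have h2 := hρ (q j)
        refine mul_le_mul (hvw j) ((h _ (q j)).trans ?_) (hρ _) (by positivity)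
        have h3 := hd j
        gcongr
    _ = Real.exp (((dilation T)⁻¹ * b + distortion T) * dist x y) * (w j • ρ (q j)) := by
        rw [add_mul, Real.exp_add, smul_eq_mul]
        ring_nf

/-- Since the bound is relative to `ρ`, the branch estimates sum exactly to the transferred `ρ`, and
no supremum norm of the operator enters. -/
theorem HolderBy.transfer (hT : IsC2NonCritical T) {α a : ℝ} {f : UnitAddCircle → ℂ}
    (h : HolderBy α a f ρ) (hα : 0 < α) (hα1 : α ≤ 1) (ha : 0 ≤ a) (hf : ∀ x, ‖f x‖ ≤ ρ x) :
    HolderBy α ((dilation T)⁻¹ ^ α * a + distortion T) (RandomCircle.transfer T f)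
      (RandomCircle.transfer T ρ) := by
  intro x y
  obtain ⟨d, p, q, v, w, -, hv, hw, hd, hvw, hwv, hx, hy⟩ := hT.exists_matching x y
  have hl : 0 ≤ (dilation T)⁻¹ := inv_nonneg.2 hT.dilation_pos.le
  have hD := distortion_nonneg T
  have hρ : ∀ x, 0 ≤ ρ x := fun x => (norm_nonneg _).trans (hf x)
  -- The distortion error is linear in the distance; as distances are below one, it is absorbed into
  -- the Hölder modulus.
  have hdd : dist x y ≤ dist x y ^ α := by
    rcases (dist_nonneg (x := x) (y := y)).eq_or_lt with h0 | h0
    · rw [← h0]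
      exact Real.rpow_nonneg le_rfl _
    · simpa using Real.rpow_le_rpow_of_exponent_ge h0 (by linarith [dist_le_half x y]) hα1
  rw [hx, hy, hx, hy, ← Finset.sum_sub_distrib, ← Finset.sum_add_distrib, Finset.mul_sum]
  refine (norm_sum_le _ _).trans (Finset.sum_le_sum fun j _ => ?_)
  have hterm := norm_smul_sub_smul_le (hv j) (hw j) (hvw j) (hwv j) (hf (p j)) (hf (q j))
    (c := a * ((dilation T)⁻¹ * dist x y) ^ α) (by positivity) (by positivity)
    ((h _ _).trans (by
      have h1 := hρ (p j)
      have h2 := hρ (q j)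
      have h3 := hd j
      gcongr))
  refine hterm.trans ?_
  simp only [smul_eq_mul]
  refine mul_le_mul_of_nonneg_right ?_
    (add_nonneg (mul_nonneg (hv j) (hρ _)) (mul_nonneg (hw j) (hρ _)))
  rw [Real.mul_rpow hl dist_nonneg]
  nlinarith [mul_le_mul_of_nonneg_left hdd hD]

/-- On the ball of radius `1 / (2 (1 + b))` around `u` the density stays above `ρ u / 2`, since
`e^(1/2) ≤ 2`, and this ball carries mass at most one. The bound is linear in `b`. -/
theorem LogLip.le_of_integral_eq_one (h : LogLip b ρ) (hb : 0 ≤ b) (hρ : ∀ x, 0 ≤ ρ x)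
    (hint : Integrable ρ) (h1 : ∫ x, ρ x = 1) (u : UnitAddCircle) : ρ u ≤ 2 * (1 + b) := by
  set δ : ℝ := 1 / (2 * (1 + b)) with hδ
  have hδ0 : 0 < δ := by positivity
  have hδ1 : 2 * δ ≤ 1 := by
    rw [hδ]
    field_simp
    linarith
  have hbd : b * δ ≤ 1 / 2 := by
    rw [hδ]
    field_simp
    linarith
  have hvol : (volume : Measure UnitAddCircle).real (Metric.closedBall u δ) = 2 * δ := by
    rw [measureReal_def, AddCircle.volume_closedBall, min_eq_right hδ1,
      ENNReal.toReal_ofReal (by positivity)]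
  have hlow : ∀ v ∈ Metric.closedBall u δ, ρ u / 2 ≤ ρ v := by
    intro v hv
    have h2 := h u v
    have h3 : Real.exp (b * dist u v) ≤ 2 := by
      have h4 : Real.exp (b * dist u v) ≤ Real.exp (1 / 2) := by
        have h5 : dist u v ≤ δ := by rw [dist_comm]; exact hv
        refine Real.exp_le_exp.2 (le_trans ?_ hbd)
        gcongr
      have h6 : Real.exp (1 / 2) ^ 2 ≤ 2 ^ 2 := by
        rw [← Real.exp_nat_mul]
        norm_num
        linarith [Real.exp_one_lt_d9]
      exact h4.trans (le_of_sq_le_sq h6 (by norm_num))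
    nlinarith [hρ v]
  have h2 : 2 * δ * (ρ u / 2) ≤ 1 := by
    calc 2 * δ * (ρ u / 2) = ∫ _ in Metric.closedBall u δ, ρ u / 2 := by
          rw [setIntegral_const, hvol, smul_eq_mul]
      _ ≤ ∫ v in Metric.closedBall u δ, ρ v :=
          setIntegral_mono_on (by simp) hint.integrableOn measurableSet_closedBall hlow
      _ ≤ ∫ v, ρ v := setIntegral_le_integral hint (Eventually.of_forall hρ)
      _ = 1 := h1
  have h3 : δ * (2 * (1 + b)) = 1 := by
    rw [hδ]
    field_simp
  by_contra hcon
  push Not at hcon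
  nlinarith [mul_lt_mul_of_pos_left hcon hδ0]

/-- Integrate `ρ v ≤ e^b ρ u` over `v`. -/
theorem LogLip.exp_neg_le_of_integral_eq_one (h : LogLip b ρ) (hb : 0 ≤ b) (hρ : ∀ x, 0 ≤ ρ x)
    (hint : Integrable ρ) (h1 : ∫ x, ρ x = 1) (u : UnitAddCircle) : Real.exp (-b) ≤ ρ u := by
  have h2 : ∀ v, ρ v ≤ Real.exp b * ρ u := fun v => (h v u).trans (by
    have h3 := hρ u
    have h4 := dist_le_half v u
    gcongr
    nlinarith)
  have h3 : 1 ≤ Real.exp b * ρ u := by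
    have h4 := integral_mono (μ := (volume : Measure UnitAddCircle)) hint
      (integrable_const (Real.exp b * ρ u)) h2
    rw [h1] at h4
    simpa using h4
  rw [Real.exp_neg, inv_le_iff_one_le_mul₀ (Real.exp_pos b)]
  linarith

theorem LogLip.abs_sub_le (h : LogLip b ρ) (hb : 0 ≤ b) (hρ : ∀ x, 0 ≤ ρ x) {M : ℝ}
    (hM : ∀ x, ρ x ≤ M) (u v : UnitAddCircle) : |ρ u - ρ v| ≤ b * M * dist u v := by
  have key : ∀ u v, ρ u - ρ v ≤ b * M * dist u v := by
    intro u v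
    have h1 : Real.exp (-(b * dist u v)) * ρ u ≤ ρ v := by
      calc Real.exp (-(b * dist u v)) * ρ u
          ≤ Real.exp (-(b * dist u v)) * (Real.exp (b * dist u v) * ρ v) := by
            gcongr
            exact h u v
        _ = ρ v := by rw [← mul_assoc, ← Real.exp_add]; simp
    have h2 := mul_le_mul_of_nonneg_right (Real.add_one_le_exp (-(b * dist u v))) (hρ u)
    have h3 : b * dist u v * ρ u ≤ b * dist u v * M := by
      gcongr
      exact hM u
    linarith
  refine abs_le.2 ⟨?_, key u v⟩
  have := key v u
  rw [dist_comm] at this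
  linarith

theorem logLip_of_abs_sub_le {L c : ℝ} (hL : 0 ≤ L) (hc : 0 < c) (hρ : ∀ x, c ≤ ρ x)
    (h : ∀ u v, |ρ u - ρ v| ≤ L * dist u v) : LogLip (L / c) ρ := by
  intro u v
  have h1 := (abs_le.1 (h u v)).2
  have h2 : L * dist u v ≤ L / c * dist u v * ρ v := by
    have : L * dist u v = L / c * dist u v * c := by field_simp
    rw [this]
    gcongr
    exact hρ v
  have h3 := mul_le_mul_of_nonneg_right (Real.add_one_le_exp (L / c * dist u v))
    (hc.le.trans (hρ v))
  linarith

theorem LogLip.continuous (h : LogLip b ρ) (hb : 0 ≤ b) (hρ : ∀ x, 0 ≤ ρ x) : Continuous ρ := by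
  have hM : ∀ x, ρ x ≤ Real.exp b * ρ 0 := fun x => (h x 0).trans (by
    have h3 := hρ 0
    have h4 := dist_le_half x 0
    gcongr
    nlinarith)
  refine continuous_of_dist_le_rpow (α := 1) (K := b * (Real.exp b * ρ 0)) one_pos fun u v => ?_
  rw [Real.rpow_one]
  exact h.abs_sub_le hb hρ hM u v

theorem HolderBy.continuous {α a : ℝ} {f : UnitAddCircle → ℂ} (h : HolderBy α a f ρ)
    (hα : 0 < α) (ha : 0 ≤ a) {M : ℝ} (hM : ∀ x, ρ x ≤ M) : Continuous f := by
  refine continuous_of_dist_le_rpow (α := α) (K := a * (M + M)) hα fun u v => ?_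
  rw [dist_eq_norm]
  refine (h u v).trans ?_
  rw [mul_right_comm]
  have h1 := hM u
  have h2 := hM v
  gcongr

end LogLip

/-! ### Measurability in the random parameter -/

section Measurability

variable {Ω : Type*} [MeasurableSpace Ω] {T : Ω → UnitAddCircle → UnitAddCircle}

theorem measurable_centeredRep : Measurable centeredRep :=
  measurable_subtype_coe.comp (AddCircle.measurableEquivIco (1 : ℝ) (-1 / 2)).measurable

theorem measurable_deriv_zero {F : Ω → ℝ → ℝ} (hF : ∀ h, Measurable fun ω => F ω h)
    (hd : ∀ ω, DifferentiableAt ℝ (F ω) 0) : Measurable fun ω => deriv (F ω) 0 := by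
  refine measurable_of_tendsto_metrizable
    (f := fun (n : ℕ) ω => (1 / ((n : ℝ) + 1))⁻¹ • (F ω (0 + 1 / ((n : ℝ) + 1)) - F ω 0))
    (fun n => ((hF _).sub (hF _)).const_mul _) (tendsto_pi_nhds.2 fun ω => ?_)
  refine (hd ω).hasDerivAt.tendsto_slope_zero.comp (tendsto_nhdsWithin_iff.2
    ⟨tendsto_one_div_add_atTop_nhds_zero_nat, Eventually.of_forall fun n => ?_⟩)
  have : (0 : ℝ) < 1 / ((n : ℝ) + 1) := by positivity
  exact this.ne'

theorem measurable_circleDeriv (hm : Measurable fun p : Ω × UnitAddCircle => T p.1 p.2)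
    (hT : ∀ ω, IsC2NonCritical (T ω)) (x : UnitAddCircle) :
    Measurable fun ω => circleDeriv (T ω) x := by
  have hm' : ∀ y, Measurable fun ω => T ω y := fun y =>
    hm.comp (measurable_id.prodMk measurable_const)
  exact measurable_deriv_zero
    (fun h => measurable_centeredRep.comp ((hm' _).sub (hm' _)))
    -- `deriv` is zero where the derivative fails to exist, so the absence of critical points
    -- already gives differentiability.
    (fun ω => differentiableAt_of_deriv_ne_zero ((hT ω).deriv_ne_zero x))

theorem measurable_circleDeriv₂ (hm : Measurable fun p : Ω × UnitAddCircle => T p.1 p.2)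
    (hT : ∀ ω, IsC2NonCritical (T ω)) (x : UnitAddCircle) :
    Measurable fun ω => circleDeriv₂ (T ω) x := by
  refine measurable_deriv_zero (fun h => measurable_circleDeriv hm hT _) fun ω => ?_
  obtain ⟨G, hG, hTG⟩ := (hT ω).exists_lift
  obtain ⟨a, rfl⟩ := exists_coe_eq x
  have h : (fun h : ℝ => circleDeriv (T ω) ((a : UnitAddCircle) + (h : UnitAddCircle)))
      = fun h => deriv G (a + h) := by
    funext h
    rw [← AddCircle.coe_add, circleDeriv_coe hTG (hG.differentiable (by norm_num) _)]
  rw [h]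
  have hd2 : Differentiable ℝ (deriv G) :=
    (ContDiff.deriv' (n := 1) hG).differentiable (by norm_num)
  exact hd2.comp (differentiable_id.const_add a) 0

theorem measurable_dilation (hm : Measurable fun p : Ω × UnitAddCircle => T p.1 p.2)
    (hT : ∀ ω, IsC2NonCritical (T ω)) : Measurable fun ω => dilation (T ω) := by
  obtain ⟨s, hs, hd⟩ := TopologicalSpace.exists_countable_dense UnitAddCircle
  have := hs.to_subtype
  have h : (fun ω => dilation (T ω)) = fun ω => ⨅ x : s, |circleDeriv (T ω) x| :=
    funext fun ω => (hd.ciInf' (hT ω).continuous_circleDeriv.abs).symm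
  rw [h]
  exact Measurable.iInf fun x => (measurable_circleDeriv hm hT _).abs

theorem measurable_distortion (hm : Measurable fun p : Ω × UnitAddCircle => T p.1 p.2)
    (hT : ∀ ω, IsC2NonCritical (T ω)) : Measurable fun ω => distortion (T ω) := by
  obtain ⟨s, hs, hd⟩ := TopologicalSpace.exists_countable_dense UnitAddCircle
  have := hs.to_subtype
  have h : (fun ω => distortion (T ω)) =
      fun ω => ⨆ x : s, |circleDeriv₂ (T ω) x / circleDeriv (T ω) x ^ 2| :=
    funext fun ω => (hd.ciSup' (hT ω).continuous_distortion_quotient).symm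
  rw [h]
  exact Measurable.iSup fun x => ((measurable_circleDeriv₂ hm hT _).div
    ((measurable_circleDeriv hm hT _).pow_const 2)).abs

theorem tendsto_average_closedBall {E : Type*} [NormedAddCommGroup E] [NormedSpace ℝ E]
    [CompleteSpace E] {g : UnitAddCircle → E} (hg : Continuous g) (x : UnitAddCircle) :
    Tendsto (fun n : ℕ => ((n : ℝ) + 1) •
      ∫ z in Metric.closedBall x (1 / (2 * ((n : ℝ) + 1))), g z) atTop (𝓝 (g x)) := by
  rw [Metric.tendsto_atTop]
  intro ε hε
  obtain ⟨δ, hδ, hgδ⟩ := Metric.continuous_iff.1 hg x (ε / 2) (by positivity)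
  obtain ⟨N, hN⟩ := exists_nat_one_div_lt hδ
  refine ⟨N, fun n hn => ?_⟩
  set r : ℝ := 1 / (2 * ((n : ℝ) + 1)) with hr
  have hr0 : 0 < r := by positivity
  have hrn : ((n : ℝ) + 1) * (2 * r) = 1 := by
    rw [hr]
    field_simp
  have hr1 : 2 * r ≤ 1 := by nlinarith [(Nat.cast_nonneg n : (0 : ℝ) ≤ n)]
  have hrδ : r < δ := by
    refine lt_of_le_of_lt ?_ hN
    have : (N : ℝ) ≤ n := by exact_mod_cast hn
    rw [hr]
    refine one_div_le_one_div_of_le (by positivity) ?_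
    linarith [(Nat.cast_nonneg n : (0 : ℝ) ≤ n)]
  have hvol : (volume : Measure UnitAddCircle).real (Metric.closedBall x r) = 2 * r := by
    rw [measureReal_def, AddCircle.volume_closedBall, min_eq_right hr1,
      ENNReal.toReal_ofReal (by positivity)]
  have hint : IntegrableOn g (Metric.closedBall x r) :=
    (hg.integrable_of_hasCompactSupport (HasCompactSupport.of_compactSpace g)).integrableOn
  have hgx : g x = ((n : ℝ) + 1) • ∫ _ in Metric.closedBall x r, g x := by
    rw [setIntegral_const, hvol, smul_smul, hrn, one_smul]
  have hlt : (volume : Measure UnitAddCircle) (Metric.closedBall x r) < ⊤ := measure_lt_top _ _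
  have hb : ‖∫ z in Metric.closedBall x r, (g z - g x)‖ ≤ ε / 2 * (2 * r) := by
    rw [← hvol]
    refine norm_setIntegral_le_of_norm_le_const hlt fun z hz => ?_
    rw [← dist_eq_norm]
    exact (hgδ z (lt_of_le_of_lt hz hrδ)).le
  calc dist (((n : ℝ) + 1) • ∫ z in Metric.closedBall x r, g z) (g x)
      = ‖((n : ℝ) + 1) • ∫ z in Metric.closedBall x r, (g z - g x)‖ := by
        rw [integral_sub hint (by simp), smul_sub, ← hgx, dist_eq_norm]
    _ ≤ ((n : ℝ) + 1) * (ε / 2 * (2 * r)) := by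
        rw [norm_smul, Real.norm_of_nonneg (by positivity)]
        gcongr
    _ = ε / 2 := by linear_combination (ε / 2) * hrn
    _ < ε := by linarith

/-- No measurable choice of inverse branches is needed. The value at `x` is a limit of averages over
balls around `x`, and by duality such an average is an integral of `F` over the set of `y` with `T
y` in the ball, which is jointly measurable in all parameters. -/
theorem stronglyMeasurable_transfer {E : Type} [NormedAddCommGroup E] [NormedSpace ℝ E]
    [CompleteSpace E] {S : Type*} [MeasurableSpace S]
    (hm : Measurable fun p : Ω × UnitAddCircle => T p.1 p.2)
    (hT : ∀ ω, IsC2NonCritical (T ω)) {F : S → UnitAddCircle → E}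
    (hF : StronglyMeasurable fun p : S × UnitAddCircle => F p.1 p.2)
    (hFc : ∀ s, Continuous (F s)) :
    StronglyMeasurable
      fun p : (Ω × S) × UnitAddCircle => transfer (T p.1.1) (F p.1.2) p.2 := by
  let A : ℕ → Set (((Ω × S) × UnitAddCircle) × UnitAddCircle) := fun n =>
    {q | dist (T q.1.1.1 q.2) q.1.2 ≤ 1 / (2 * ((n : ℝ) + 1))}
  have hA : ∀ n, MeasurableSet (A n) := by
    intro n
    have h1 : Measurable fun q : ((Ω × S) × UnitAddCircle) × UnitAddCircle => T q.1.1.1 q.2 :=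
      hm.comp (measurable_fst.fst.fst.prodMk measurable_snd)
    exact measurableSet_le (h1.dist measurable_fst.snd) measurable_const
  have hF' : StronglyMeasurable
      fun q : ((Ω × S) × UnitAddCircle) × UnitAddCircle => F q.1.1.2 q.2 :=
    hF.comp_measurable (measurable_fst.fst.snd.prodMk measurable_snd)
  refine stronglyMeasurable_of_tendsto (atTop : Filter ℕ)
    (f := fun n p => ((n : ℝ) + 1) • ∫ y, (A n).indicator (fun q => F q.1.1.2 q.2) (p, y))
    (fun n => ((hF'.indicator (hA n)).integral_prod_right').const_smul _)
    (tendsto_pi_nhds.2 fun p => ?_)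
  have hc := (hT p.1.1).continuous_transfer (hFc p.1.2)
  convert tendsto_average_closedBall hc p.2 using 2 with n
  congr 1
  set B := Metric.closedBall p.2 (1 / (2 * ((n : ℝ) + 1))) with hB
  have hBm : MeasurableSet B := measurableSet_closedBall
  have h1 : ∀ y, (A n).indicator (fun q => F q.1.1.2 q.2) (p, y)
      = (B.indicator (fun _ => (1 : ℝ)) (T p.1.1 y)) • F p.1.2 y := by
    intro y
    by_cases hy : T p.1.1 y ∈ B
    · rw [indicator_of_mem hy, indicator_of_mem (show (p, y) ∈ A n from hy), one_smul]
    · rw [indicator_of_notMem hy, indicator_of_notMem (show (p, y) ∉ A n from hy), zero_smul]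
  simp_rw [h1]
  have hint : Integrable fun y => (B.indicator (fun _ => (1 : ℝ)) (T p.1.1 y)) • F p.1.2 y := by
    have h2 := ((hFc p.1.2).integrable_of_hasCompactSupport (μ := volume)
      (HasCompactSupport.of_compactSpace _)).indicator ((hT p.1.1).continuous.measurable hBm)
    refine h2.congr (Eventually.of_forall fun y => ?_)
    by_cases hy : T p.1.1 y ∈ B
    · rw [indicator_of_mem (show y ∈ T p.1.1 ⁻¹' B from hy)]
      simp [indicator_of_mem hy]
    · rw [indicator_of_notMem (show y ∉ T p.1.1 ⁻¹' B from hy)]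
      simp [indicator_of_notMem hy]
  rw [← (hT p.1.1).integral_transfer hint, ← integral_indicator hBm]
  congr 1
  funext z
  rw [(hT p.1.1).transfer_comp_smul]
  by_cases hz : z ∈ B <;> simp [hz]

end Measurability

end RandomCircle

/-! ### The averaged transfer operator -/

namespace RandomCircle

open Filter Topology Set

universe u

variable {Ω : Type u} [MeasurableSpace Ω] {η : Measure Ω} {T : Ω → UnitAddCircle → UnitAddCircle}

/-- A random family of `C²` circle maps which is expanding on average and has square integrable
distortion. -/
structure ExpandingOnAverage (η : Measure Ω) (T : Ω → UnitAddCircle → UnitAddCircle) : Prop where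
  measurable : Measurable fun p : Ω × UnitAddCircle => T p.1 p.2
  isC2 : ∀ ω, IsC2NonCritical (T ω)
  integrable_dilation : Integrable (fun ω => (dilation (T ω))⁻¹ ^ 2) η
  integral_dilation_lt : ∫ ω, (dilation (T ω))⁻¹ ^ 2 ∂η < 1
  integrable_distortion : Integrable (fun ω => distortion (T ω) ^ 2) η

/-- The averaged transfer operator, the dual of the Markov operator. -/
noncomputable def avgTransfer {E : Type*} [NormedAddCommGroup E] [NormedSpace ℝ E]
    (η : Measure Ω) (T : Ω → UnitAddCircle → UnitAddCircle) (f : UnitAddCircle → E)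
    (x : UnitAddCircle) : E :=
  ∫ ω, transfer (T ω) f x ∂η

theorem integrable_of_continuous {E : Type*} [NormedAddCommGroup E] {f : UnitAddCircle → E}
    (hf : Continuous f) : Integrable f :=
  hf.integrable_of_hasCompactSupport (HasCompactSupport.of_compactSpace f)

theorem exists_norm_le_of_continuous {E : Type*} [NormedAddCommGroup E] {f : UnitAddCircle → E}
    (hf : Continuous f) : ∃ c, 0 ≤ c ∧ ∀ x, ‖f x‖ ≤ c := by
  obtain ⟨c, hc⟩ := (isCompact_range hf.norm).bddAbove
  exact ⟨c, (norm_nonneg _).trans (hc ⟨0, rfl⟩), fun x => hc ⟨x, rfl⟩⟩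

/-- The transfer of the constant one is a probability density with log-Lipschitz constant
`distortion T`, hence at most `2 (1 + distortion T)`. This is the integrable majorant in `ω` behind
every dominated convergence and Fubini argument for the averaged operator. -/
theorem IsC2NonCritical.norm_transfer_le_const {E : Type} [NormedAddCommGroup E]
    [NormedSpace ℝ E] {T : UnitAddCircle → UnitAddCircle} (hT : IsC2NonCritical T)
    {f : UnitAddCircle → E} {c : ℝ} (hc : 0 ≤ c) (hf : ∀ x, ‖f x‖ ≤ c) (x : UnitAddCircle) :
    ‖transfer T f x‖ ≤ c * (2 * (1 + distortion T)) := by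
  have h0 : LogLip 0 fun _ : UnitAddCircle => (1 : ℝ) := fun u v => by simp
  have h1 := h0.transfer hT le_rfl fun _ => zero_le_one
  rw [mul_zero, zero_add] at h1
  have h2 := hT.transfer_nonneg (ρ := fun _ => (1 : ℝ)) fun _ => zero_le_one
  have hcont : Continuous fun _ : UnitAddCircle => (1 : ℝ) := continuous_const
  have h3 := h1.le_of_integral_eq_one (distortion_nonneg T) h2
    (integrable_of_continuous (hT.continuous_transfer hcont))
    ((hT.integral_transfer (integrable_of_continuous hcont)).trans (by simp)) x
  have h4 := hT.transfer_comp_smul (fun _ => c) (fun _ => (1 : ℝ)) x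
  simp only [smul_eq_mul, mul_one] at h4
  refine (hT.norm_transfer_le hf x).trans ?_
  rw [h4]
  gcongr

namespace ExpandingOnAverage

variable (h : ExpandingOnAverage η T) [IsProbabilityMeasure η]

include h

theorem integrable_distortion_one : Integrable (fun ω => distortion (T ω)) η := by
  refine (h.integrable_distortion.add (integrable_const 1)).mono'
    (measurable_distortion h.measurable h.isC2).aestronglyMeasurable
    (Eventually.of_forall fun ω => ?_)
  rw [Real.norm_of_nonneg (distortion_nonneg _)]
  simp only [Pi.add_apply]
  nlinarith [sq_nonneg (distortion (T ω) - 1), distortion_nonneg (T ω)]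

theorem integrable_bound (c : ℝ) : Integrable (fun ω => c * (2 * (1 + distortion (T ω)))) η :=
  (((integrable_const 1).add h.integrable_distortion_one).const_mul 2).const_mul c

variable {E F : Type} [NormedAddCommGroup E] [NormedSpace ℝ E] [CompleteSpace E]
  [NormedAddCommGroup F] [NormedSpace ℝ F] [CompleteSpace F]

omit [IsProbabilityMeasure η] in
theorem stronglyMeasurable_transfer_uncurry {f : UnitAddCircle → E} (hf : Continuous f) :
    StronglyMeasurable fun p : Ω × UnitAddCircle => transfer (T p.1) f p.2 := by
  have h1 := stronglyMeasurable_transfer (S := Unit) h.measurable h.isC2 (F := fun _ => f)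
    (hf.comp continuous_snd).stronglyMeasurable (fun _ => hf)
  exact h1.comp_measurable
    (g := fun p : Ω × UnitAddCircle => ((p.1, ()), p.2))
    ((measurable_fst.prodMk measurable_const).prodMk measurable_snd)

theorem integrable_transfer {f : UnitAddCircle → E} (hf : Continuous f) (x : UnitAddCircle) :
    Integrable (fun ω => transfer (T ω) f x) η := by
  obtain ⟨c, hc0, hc⟩ := exists_norm_le_of_continuous hf
  refine (h.integrable_bound c).mono' ?_
    (Eventually.of_forall fun ω => (h.isC2 ω).norm_transfer_le_const hc0 hc x)
  exact ((h.stronglyMeasurable_transfer_uncurry hf).comp_measurable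
    (measurable_id.prodMk measurable_const)).aestronglyMeasurable

theorem continuous_avgTransfer {f : UnitAddCircle → E} (hf : Continuous f) :
    Continuous (avgTransfer η T f) := by
  obtain ⟨c, hc0, hc⟩ := exists_norm_le_of_continuous hf
  exact continuous_of_dominated (fun x => (h.integrable_transfer hf x).aestronglyMeasurable)
    (fun x => Eventually.of_forall fun ω => (h.isC2 ω).norm_transfer_le_const hc0 hc x)
    (h.integrable_bound c)
    (Eventually.of_forall fun ω => (h.isC2 ω).continuous_transfer hf)

theorem avgTransfer_add {f g : UnitAddCircle → E} (hf : Continuous f) (hg : Continuous g) :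
    avgTransfer η T (fun y => f y + g y) = fun x => avgTransfer η T f x + avgTransfer η T g x := by
  funext x
  simp_rw [avgTransfer, (h.isC2 _).transfer_add]
  exact integral_add (h.integrable_transfer hf x) (h.integrable_transfer hg x)

theorem avgTransfer_clm {f : UnitAddCircle → E} (hf : Continuous f) (l : E →L[ℝ] F) :
    avgTransfer η T (fun y => l (f y)) = fun x => l (avgTransfer η T f x) := by
  funext x
  simp_rw [avgTransfer, (h.isC2 _).transfer_clm]
  exact l.integral_comp_comm (h.integrable_transfer hf x)

theorem avgTransfer_const_mul {f : UnitAddCircle → ℝ} (hf : Continuous f) (c : ℝ) :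
    avgTransfer η T (fun y => c * f y) = fun x => c * avgTransfer η T f x :=
  h.avgTransfer_clm hf (ContinuousLinearMap.mul ℝ ℝ c)

omit [CompleteSpace E] in
theorem norm_avgTransfer_le {f : UnitAddCircle → E} {ρ : UnitAddCircle → ℝ}
    (hρ : Continuous ρ) (hfρ : ∀ x, ‖f x‖ ≤ ρ x) (x : UnitAddCircle) :
    ‖avgTransfer η T f x‖ ≤ avgTransfer η T ρ x :=
  norm_integral_le_of_norm_le (h.integrable_transfer hρ x)
    (Eventually.of_forall fun ω => (h.isC2 ω).norm_transfer_le hfρ x)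

/-- Duality of the averaged operator with the Markov operator: the change of variables for each
fixed `ω`, between two applications of Fubini. -/
theorem integral_mul_avgTransfer {𝕜 : Type} [RCLike 𝕜] {ψ f : UnitAddCircle → 𝕜}
    (hψ : Measurable ψ) {B : ℝ} (hB : ∀ x, ‖ψ x‖ ≤ B) (hf : Continuous f) :
    ∫ x, ψ x * avgTransfer η T f x = ∫ x, (∫ ω, ψ (T ω x) ∂η) * f x := by
  obtain ⟨c, hc0, hc⟩ := exists_norm_le_of_continuous hf
  have hB0 : 0 ≤ B := (norm_nonneg _).trans (hB 0)
  have hint : Integrable (fun p : UnitAddCircle × Ω => ψ p.1 * transfer (T p.2) f p.1)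
      ((volume : Measure UnitAddCircle).prod η) := by
    refine ((h.integrable_bound (B * c)).comp_snd volume).mono' ?_
      (Eventually.of_forall fun p => ?_)
    · exact ((hψ.comp measurable_fst).stronglyMeasurable.mul
        ((h.stronglyMeasurable_transfer_uncurry hf).comp_measurable
          measurable_swap)).aestronglyMeasurable
    · rw [norm_mul, mul_assoc]
      exact mul_le_mul (hB _) ((h.isC2 _).norm_transfer_le_const hc0 hc _) (norm_nonneg _) hB0
  have hint' : Integrable (fun p : UnitAddCircle × Ω => ψ (T p.2 p.1) * f p.1)
      ((volume : Measure UnitAddCircle).prod η) := by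
    refine Integrable.of_bound ?_ (B * c) (Eventually.of_forall fun p => ?_)
    · exact ((hψ.comp (h.measurable.comp measurable_swap)).mul
        (hf.measurable.comp measurable_fst)).aestronglyMeasurable
    · rw [norm_mul]
      exact mul_le_mul (hB _) (hc _) (norm_nonneg _) hB0
  calc ∫ x, ψ x * avgTransfer η T f x
      = ∫ x, ∫ ω, ψ x * transfer (T ω) f x ∂η := by
        simp_rw [avgTransfer, ← integral_const_mul]
    _ = ∫ ω, ∫ x, ψ x * transfer (T ω) f x ∂volume ∂η := integral_integral_swap hint
    _ = ∫ ω, ∫ x, ψ (T ω x) * f x ∂volume ∂η := by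
        congr 1
        funext ω
        have h1 : Integrable fun x => ψ (T ω x) • f x := by
          refine Integrable.of_bound ?_ (B * c) (Eventually.of_forall fun p => ?_)
          · exact ((hψ.comp (h.isC2 ω).continuous.measurable).mul
              hf.measurable).aestronglyMeasurable
          · rw [smul_eq_mul, norm_mul]
            exact mul_le_mul (hB _) (hc _) (norm_nonneg _) hB0
        have h2 := (h.isC2 ω).integral_transfer h1
        simp_rw [(h.isC2 ω).transfer_comp_smul] at h2
        exact h2
    _ = ∫ x, ∫ ω, ψ (T ω x) * f x ∂η := (integral_integral_swap hint').symm
    _ = ∫ x, (∫ ω, ψ (T ω x) ∂η) * f x := by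
        simp_rw [integral_mul_const]

theorem integral_avgTransfer {𝕜 : Type} [RCLike 𝕜] {f : UnitAddCircle → 𝕜} (hf : Continuous f) :
    ∫ x, avgTransfer η T f x = ∫ x, f x := by
  have := h.integral_mul_avgTransfer (ψ := fun _ => (1 : 𝕜)) measurable_const (B := 1)
    (fun _ => by simp) hf
  simpa using this

theorem integral_norm_avgTransfer_le {f : UnitAddCircle → E} (hf : Continuous f) :
    ∫ x, ‖avgTransfer η T f x‖ ≤ ∫ x, ‖f x‖ := by
  rw [← h.integral_avgTransfer hf.norm]
  exact integral_mono (integrable_of_continuous (h.continuous_avgTransfer hf).norm)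
    (integrable_of_continuous (h.continuous_avgTransfer hf.norm))
    (h.norm_avgTransfer_le hf.norm fun _ => le_rfl)

end ExpandingOnAverage

/-! ### Mixtures and contraction of their second moments -/

/-- A representation of the pair `(f, φ)` as an average of pairs `(F s, ρ s)` in which `ρ s` is a
probability density with log-Lipschitz constant `b s`, and `F s` is dominated by `ρ s` and has
relative Hölder constant `a s`; the second moments of `a` and `b` are at most `A` and `B`. -/
structure Mixture (α A B : ℝ) (f : UnitAddCircle → ℂ) (φ : UnitAddCircle → ℝ) :
    Type (u + 1) where
  S : Type u
  mS : MeasurableSpace S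
  ν : Measure S
  prob : IsProbabilityMeasure ν
  F : S → UnitAddCircle → ℂ
  ρ : S → UnitAddCircle → ℝ
  a : S → ℝ
  b : S → ℝ
  measurable_F : StronglyMeasurable fun p : S × UnitAddCircle => F p.1 p.2
  measurable_ρ : StronglyMeasurable fun p : S × UnitAddCircle => ρ p.1 p.2
  measurable_a : Measurable a
  measurable_b : Measurable b
  a_nonneg : ∀ s, 0 ≤ a s
  b_nonneg : ∀ s, 0 ≤ b s
  norm_le : ∀ s x, ‖F s x‖ ≤ ρ s x
  holder : ∀ s, HolderBy α (a s) (F s) (ρ s)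
  logLip : ∀ s, LogLip (b s) (ρ s)
  integral_ρ : ∀ s, ∫ x, ρ s x = 1
  integrable_a : Integrable (fun s => a s ^ 2) ν
  integrable_b : Integrable (fun s => b s ^ 2) ν
  moment_a : ∫ s, a s ^ 2 ∂ν ≤ A
  moment_b : ∫ s, b s ^ 2 ∂ν ≤ B
  f_eq : ∀ x, f x = ∫ s, F s x ∂ν
  φ_eq : ∀ x, φ x = ∫ s, ρ s x ∂ν

attribute [instance] Mixture.mS Mixture.prob

namespace Mixture

variable {α A B : ℝ} {f : UnitAddCircle → ℂ} {φ : UnitAddCircle → ℝ}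

/-- A pair of functions as a mixture with a single component. -/
noncomputable def single {a b : ℝ} (ha : 0 ≤ a) (hb : 0 ≤ b) (hf : Continuous f) (hfφ : ∀ x, ‖f x‖ ≤ φ x)
    (hH : HolderBy α a f φ) (hL : LogLip b φ) (h1 : ∫ x, φ x = 1) :
    Mixture.{u} α (a ^ 2) (b ^ 2) f φ where
  S := PUnit
  mS := inferInstance
  ν := Measure.dirac PUnit.unit
  prob := inferInstance
  F _ := f
  ρ _ := φ
  a _ := a
  b _ := b
  measurable_F := (hf.comp continuous_snd).stronglyMeasurable
  measurable_ρ := ((hL.continuous hb fun x => (norm_nonneg _).trans (hfφ x)).comp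
    continuous_snd).stronglyMeasurable
  measurable_a := measurable_const
  measurable_b := measurable_const
  a_nonneg _ := ha
  b_nonneg _ := hb
  norm_le _ := hfφ
  holder _ := hH
  logLip _ := hL
  integral_ρ _ := h1
  integrable_a := integrable_const _
  integrable_b := integrable_const _
  moment_a := by simp
  moment_b := by simp
  f_eq _ := by simp
  φ_eq _ := by simp

/-- The moment bounds of a mixture may be increased. -/
def mono {A' B' : ℝ} (M : Mixture.{u} α A B f φ) (hA : A ≤ A') (hB : B ≤ B') :
    Mixture.{u} α A' B' f φ :=
  { M with moment_a := M.moment_a.trans hA, moment_b := M.moment_b.trans hB }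

variable (M : Mixture.{u} α A B f φ)

include M

theorem ρ_nonneg (s : M.S) (x : UnitAddCircle) : 0 ≤ M.ρ s x :=
  (norm_nonneg _).trans (M.norm_le s x)

theorem continuous_ρ (s : M.S) : Continuous (M.ρ s) :=
  (M.logLip s).continuous (M.b_nonneg s) (M.ρ_nonneg s)

theorem ρ_le (s : M.S) (x : UnitAddCircle) : M.ρ s x ≤ 2 * (1 + M.b s) :=
  (M.logLip s).le_of_integral_eq_one (M.b_nonneg s) (M.ρ_nonneg s)
    (integrable_of_continuous (M.continuous_ρ s)) (M.integral_ρ s) x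

theorem continuous_F (hα : 0 < α) (s : M.S) : Continuous (M.F s) :=
  (M.holder s).continuous hα (M.a_nonneg s) (M.ρ_le s)

theorem integrable_ρ (x : UnitAddCircle) : Integrable (fun s => M.ρ s x) M.ν := by
  refine ((integrable_const 3).add M.integrable_b).mono'
    (M.measurable_ρ.comp_measurable (measurable_id.prodMk measurable_const)).aestronglyMeasurable
    (Eventually.of_forall fun s => ?_)
  rw [Real.norm_of_nonneg (M.ρ_nonneg s x)]
  simp only [Pi.add_apply]
  nlinarith [M.ρ_le s x, sq_nonneg (M.b s - 1)]

theorem integrable_F (x : UnitAddCircle) : Integrable (fun s => M.F s x) M.ν :=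
  (M.integrable_ρ x).mono'
    (M.measurable_F.comp_measurable (measurable_id.prodMk measurable_const)).aestronglyMeasurable
    (Eventually.of_forall fun s => M.norm_le s x)

theorem norm_f_le (x : UnitAddCircle) : ‖f x‖ ≤ φ x := by
  rw [M.f_eq, M.φ_eq]
  exact norm_integral_le_of_norm_le (M.integrable_ρ x)
    (Eventually.of_forall fun s => M.norm_le s x)

theorem φ_le (x : UnitAddCircle) : φ x ≤ 3 + B := by
  rw [M.φ_eq]
  calc ∫ s, M.ρ s x ∂M.ν ≤ ∫ s, (3 + M.b s ^ 2) ∂M.ν := by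
        refine integral_mono (M.integrable_ρ x) ((integrable_const 3).add M.integrable_b) fun s => ?_
        simp only
        nlinarith [M.ρ_le s x, sq_nonneg (M.b s - 1)]
    _ ≤ 3 + B := by
        rw [integral_add (integrable_const 3) M.integrable_b]
        simpa using M.moment_b

/-- Each component has Lipschitz constant at most `b * 2 (1 + b) ≤ 1 + 3 b²`, so the second moment
suffices. -/
theorem abs_φ_sub_le (u v : UnitAddCircle) : |φ u - φ v| ≤ (1 + 3 * B) * dist u v := by
  rw [M.φ_eq, M.φ_eq, ← integral_sub (M.integrable_ρ u) (M.integrable_ρ v)]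
  have hint : Integrable (fun s => (1 + 3 * M.b s ^ 2) * dist u v) M.ν :=
    ((integrable_const 1).add (M.integrable_b.const_mul 3)).mul_const _
  have h1 : ‖∫ s, (M.ρ s u - M.ρ s v) ∂M.ν‖ ≤ ∫ s, (1 + 3 * M.b s ^ 2) * dist u v ∂M.ν := by
    refine norm_integral_le_of_norm_le hint (Eventually.of_forall fun s => ?_)
    refine ((M.logLip s).abs_sub_le (M.b_nonneg s) (M.ρ_nonneg s) (M.ρ_le s) u v).trans ?_
    gcongr
    nlinarith [sq_nonneg (M.b s - 1)]
  refine h1.trans ?_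
  rw [integral_mul_const, integral_add (integrable_const 1) (M.integrable_b.const_mul 3),
    integral_const_mul]
  have h2 := M.moment_b
  gcongr
  simp

/-- The relative bound becomes absolute through `ρ ≤ 2 (1 + b)`, and `4 a (1 + b) ≤ 2 + 4 a² + 2
b²`. -/
theorem norm_f_sub_le (u v : UnitAddCircle) :
    ‖f u - f v‖ ≤ (2 + 4 * A + 2 * B) * dist u v ^ α := by
  rw [M.f_eq, M.f_eq, ← integral_sub (M.integrable_F u) (M.integrable_F v)]
  have hia : Integrable (fun s => 2 + 4 * M.a s ^ 2) M.ν :=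
    (integrable_const 2).add (M.integrable_a.const_mul 4)
  have hint : Integrable (fun s => (2 + 4 * M.a s ^ 2 + 2 * M.b s ^ 2) * dist u v ^ α) M.ν :=
    (hia.add (M.integrable_b.const_mul 2)).mul_const _
  have h1 : ‖∫ s, (M.F s u - M.F s v) ∂M.ν‖ ≤
      ∫ s, (2 + 4 * M.a s ^ 2 + 2 * M.b s ^ 2) * dist u v ^ α ∂M.ν := by
    refine norm_integral_le_of_norm_le hint (Eventually.of_forall fun s => ?_)
    refine (M.holder s u v).trans ?_
    rw [mul_right_comm]
    have hd : 0 ≤ dist u v ^ α := Real.rpow_nonneg dist_nonneg _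
    gcongr
    have h2 := M.ρ_le s u
    have h3 := M.ρ_le s v
    have h4 := M.a_nonneg s
    calc M.a s * (M.ρ s u + M.ρ s v) ≤ M.a s * (2 * (1 + M.b s) + 2 * (1 + M.b s)) := by gcongr
      _ ≤ _ := by nlinarith [sq_nonneg (M.a s - 1), sq_nonneg (M.a s - M.b s)]
  refine h1.trans ?_
  rw [integral_mul_const, integral_add hia (M.integrable_b.const_mul 2),
    integral_add (integrable_const 2) (M.integrable_a.const_mul 4),
    integral_const_mul, integral_const_mul]
  have h2 := M.moment_b
  have h3 := M.moment_a
  have hd : 0 ≤ dist u v ^ α := Real.rpow_nonneg dist_nonneg _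
  gcongr
  simp

/-- Each component is at least `e^(-b)`, and the mean of `b` is at most `1 + B`. Jensen's inequality
is applied in the form of the tangent line of `e^(-b)` at `b = 1 + B`. -/
theorem exp_neg_le_φ (x : UnitAddCircle) : Real.exp (-(1 + B)) ≤ φ x := by
  have hb : Integrable M.b M.ν := by
    refine ((integrable_const 1).add M.integrable_b).mono' M.measurable_b.aestronglyMeasurable
      (Eventually.of_forall fun s => ?_)
    rw [Real.norm_of_nonneg (M.b_nonneg s)]
    simp only [Pi.add_apply]
    nlinarith [sq_nonneg (M.b s - 1), M.b_nonneg s]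
  have hEb : ∫ s, M.b s ∂M.ν ≤ 1 + B := by
    calc ∫ s, M.b s ∂M.ν ≤ ∫ s, (1 + M.b s ^ 2) ∂M.ν := by
          refine integral_mono hb ((integrable_const 1).add M.integrable_b) fun s => ?_
          simp only
          nlinarith [sq_nonneg (M.b s - 1), M.b_nonneg s]
      _ ≤ 1 + B := by
          rw [integral_add (integrable_const 1) M.integrable_b]
          simpa using M.moment_b
  have hint : Integrable (fun s => Real.exp (-(1 + B)) * ((2 + B) - M.b s)) M.ν :=
    ((integrable_const _).sub hb).const_mul _
  calc Real.exp (-(1 + B)) ≤ ∫ s, Real.exp (-(1 + B)) * ((2 + B) - M.b s) ∂M.ν := by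
        rw [integral_const_mul, integral_sub (integrable_const _) hb]
        simp only [integral_const, probReal_univ, smul_eq_mul, one_mul]
        nlinarith [Real.exp_pos (-(1 + B))]
    _ ≤ ∫ s, M.ρ s x ∂M.ν := by
        refine integral_mono hint (M.integrable_ρ x) fun s => ?_
        refine le_trans ?_ ((M.logLip s).exp_neg_le_of_integral_eq_one (M.b_nonneg s)
          (M.ρ_nonneg s) (integrable_of_continuous (M.continuous_ρ s)) (M.integral_ρ s) x)
        have h1 := Real.add_one_le_exp (1 + B - M.b s)
        calc Real.exp (-(1 + B)) * ((2 + B) - M.b s)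
            ≤ Real.exp (-(1 + B)) * Real.exp (1 + B - M.b s) := by
              gcongr
              linarith
          _ = Real.exp (-M.b s) := by
              rw [← Real.exp_add]
              ring_nf
    _ = φ x := (M.φ_eq x).symm

end Mixture

/-- Young's inequality separates the square, and independence of the two coordinates factors the
second moment of the product. The parameter `t` keeps the loss in front of the contracting factor
small. -/
theorem integrable_sq_add_and_integral_le {S : Type*} [MeasurableSpace S] {ν : Measure S}
    [IsProbabilityMeasure ν] [IsProbabilityMeasure η] {l c : Ω → ℝ} {a : S → ℝ}
    (hl : Measurable l) (hc : Measurable c) (ha : Measurable a)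
    (hl2 : Integrable (fun ω => l ω ^ 2) η) (hc2 : Integrable (fun ω => c ω ^ 2) η)
    (ha2 : Integrable (fun s => a s ^ 2) ν) {t : ℝ} (ht : 0 < t) :
    Integrable (fun p : Ω × S => (l p.1 * a p.2 + c p.1) ^ 2) (η.prod ν) ∧
    ∫ p : Ω × S, (l p.1 * a p.2 + c p.1) ^ 2 ∂(η.prod ν) ≤
      (1 + t) * (∫ ω, l ω ^ 2 ∂η) * ∫ s, a s ^ 2 ∂ν + (1 + t⁻¹) * ∫ ω, c ω ^ 2 ∂η := by
  have h1 : Integrable (fun p : Ω × S => l p.1 ^ 2 * a p.2 ^ 2) (η.prod ν) := hl2.mul_prod ha2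
  have h2 : Integrable (fun p : Ω × S => c p.1 ^ 2) (η.prod ν) := hc2.comp_fst ν
  have h3 : Integrable (fun p : Ω × S => (1 + t) * (l p.1 ^ 2 * a p.2 ^ 2)
      + (1 + t⁻¹) * c p.1 ^ 2) (η.prod ν) := (h1.const_mul _).add (h2.const_mul _)
  have hle : ∀ p : Ω × S, (l p.1 * a p.2 + c p.1) ^ 2 ≤
      (1 + t) * (l p.1 ^ 2 * a p.2 ^ 2) + (1 + t⁻¹) * c p.1 ^ 2 := by
    intro p
    have h4 : 0 ≤ t⁻¹ * (t * (l p.1 * a p.2) - c p.1) ^ 2 := by positivity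
    have h5 : t⁻¹ * (t * (l p.1 * a p.2) - c p.1) ^ 2 = t * (l p.1 ^ 2 * a p.2 ^ 2)
        - 2 * (l p.1 * a p.2 * c p.1) + t⁻¹ * c p.1 ^ 2 := by
      field_simp
      ring
    nlinarith
  have h6 : Integrable (fun p : Ω × S => (l p.1 * a p.2 + c p.1) ^ 2) (η.prod ν) := by
    refine h3.mono' ?_ (Eventually.of_forall fun p => ?_)
    · exact (((hl.comp measurable_fst).mul (ha.comp measurable_snd)).add
        (hc.comp measurable_fst)).pow_const 2 |>.aestronglyMeasurable
    · rw [Real.norm_of_nonneg (sq_nonneg _)]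
      exact hle p
  refine ⟨h6, (integral_mono h6 h3 hle).trans_eq ?_⟩
  rw [integral_add (h1.const_mul _) (h2.const_mul _), integral_const_mul, integral_const_mul,
    integral_prod_mul (fun ω => l ω ^ 2) (fun s => a s ^ 2),
    integral_fun_fst (fun ω => c ω ^ 2)]
  simp
  ring

theorem rpow_le_affine {x α : ℝ} (hx : 0 ≤ x) (hα : 0 ≤ α) (hα1 : α ≤ 1) :
    x ^ α ≤ 1 + α * (x - 1) := by
  have := rpow_one_add_le_one_add_mul_self (s := x - 1) (by linarith) hα hα1
  rwa [add_sub_cancel] at this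

namespace ExpandingOnAverage

variable (h : ExpandingOnAverage η T) [IsProbabilityMeasure η] {α : ℝ}

include h

omit [IsProbabilityMeasure η] in
theorem measurable_inv_dilation_rpow (α : ℝ) :
    Measurable fun ω => (dilation (T ω))⁻¹ ^ α :=
  (measurable_dilation h.measurable h.isC2).inv.pow_const α

/-- Concavity of `x ↦ x^α` at `x = λ⁻²`, through its tangent at one. The resulting bound is below
one for every positive `α`. -/
theorem integrable_dilation_rpow (hα : 0 ≤ α) (hα1 : α ≤ 1) :
    Integrable (fun ω => ((dilation (T ω))⁻¹ ^ α) ^ 2) η ∧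
    ∫ ω, ((dilation (T ω))⁻¹ ^ α) ^ 2 ∂η ≤ 1 + α * (∫ ω, (dilation (T ω))⁻¹ ^ 2 ∂η - 1) := by
  have hle : ∀ ω, ((dilation (T ω))⁻¹ ^ α) ^ 2 ≤ 1 + α * ((dilation (T ω))⁻¹ ^ 2 - 1) := by
    intro ω
    have h0 : 0 ≤ (dilation (T ω))⁻¹ := inv_nonneg.2 (h.isC2 ω).dilation_pos.le
    rw [← Real.rpow_mul_natCast h0, mul_comm α, Real.rpow_mul h0]
    norm_num only [Real.rpow_natCast]
    exact_mod_cast rpow_le_affine (by positivity) hα hα1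
  have hi0 : Integrable (fun ω => α * ((dilation (T ω))⁻¹ ^ 2 - 1)) η :=
    (h.integrable_dilation.sub (integrable_const 1)).const_mul α
  have hi : Integrable (fun ω => 1 + α * ((dilation (T ω))⁻¹ ^ 2 - 1)) η :=
    (integrable_const 1).add hi0
  have hi' : Integrable (fun ω => ((dilation (T ω))⁻¹ ^ α) ^ 2) η := by
    refine hi.mono' ((h.measurable_inv_dilation_rpow α).pow_const 2).aestronglyMeasurable
      (Eventually.of_forall fun ω => ?_)
    rw [Real.norm_of_nonneg (sq_nonneg _)]
    exact hle ω
  refine ⟨hi', (integral_mono hi' hi hle).trans_eq ?_⟩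
  rw [integral_add (integrable_const 1) hi0, integral_const_mul,
    integral_sub h.integrable_dilation (integrable_const 1)]
  simp

/-- Multiplication by an `α`-Hölder function followed by the averaged transfer operator acts on
mixtures, and contracts their second moments up to a constant. -/
theorem exists_mixture_step (hα : 0 < α) (hα1 : α ≤ 1) {K : ℝ} (hK : 0 ≤ K) :
    ∃ q C : ℝ, 0 ≤ q ∧ q < 1 ∧ 0 ≤ C ∧ ∀ (A B : ℝ) (f g : UnitAddCircle → ℂ)
      (φ : UnitAddCircle → ℝ), (∀ x, ‖g x‖ ≤ 1) → (∀ u v, ‖g u - g v‖ ≤ K * dist u v ^ α) →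
      Mixture.{u} α A B f φ →
      Nonempty (Mixture.{u} α (q * A + C) (q * B + C) (avgTransfer η T fun x => g x * f x)
        (avgTransfer η T φ)) := by
  obtain ⟨hli, hlle⟩ := h.integrable_dilation_rpow hα.le hα1
  set R : ℝ := 1 + α * (∫ ω, (dilation (T ω))⁻¹ ^ 2 ∂η - 1) with hR
  set l : Ω → ℝ := fun ω => (dilation (T ω))⁻¹ with hl
  have hl0 : ∀ ω, 0 ≤ l ω := fun ω => inv_nonneg.2 (h.isC2 ω).dilation_pos.le
  have hR1 : R < 1 := by nlinarith [h.integral_dilation_lt]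
  have hR0 : 0 ≤ R := (integral_nonneg fun ω => sq_nonneg _).trans hlle
  -- As `α ≤ 1`, `R` also bounds the mean of `λ⁻²`, so one factor contracts both moments.
  have hlR : ∫ ω, l ω ^ 2 ∂η ≤ R := by nlinarith [h.integral_dilation_lt]
  -- With this `t` one has `(1 + t) * R < 1`.
  set t : ℝ := (1 - R) / 2 with ht
  have ht0 : 0 < t := by linarith
  have hlm : Measurable l := (measurable_dilation h.measurable h.isC2).inv
  have hlαm : Measurable fun ω => l ω ^ α := h.measurable_inv_dilation_rpow α
  have hDm := measurable_distortion h.measurable h.isC2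
  -- Multiplication by `g` raises `a` to `a + K` before the transfer, and `c` is the resulting
  -- additive term. It dominates the distortion, so the same constant serves `b`.
  set c : Ω → ℝ := fun ω => l ω ^ α * K + distortion (T ω) with hc
  have hcm : Measurable c := (hlαm.mul_const K).add hDm
  have hc2 : Integrable (fun ω => c ω ^ 2) η := by
    refine (((hli.const_mul (K ^ 2)).add h.integrable_distortion).const_mul 2).mono'
      (hcm.pow_const 2).aestronglyMeasurable (Eventually.of_forall fun ω => ?_)
    rw [Real.norm_of_nonneg (sq_nonneg _)]
    simp only [hc, Pi.add_apply]
    nlinarith [sq_nonneg (l ω ^ α * K - distortion (T ω))]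
  have hDc : ∫ ω, distortion (T ω) ^ 2 ∂η ≤ ∫ ω, c ω ^ 2 ∂η := by
    refine integral_mono h.integrable_distortion hc2 fun ω => ?_
    refine pow_le_pow_left₀ (distortion_nonneg _) ?_ 2
    have := Real.rpow_nonneg (hl0 ω) α
    simp only [hc]
    linarith [mul_nonneg this hK]
  have hI0 : 0 ≤ ∫ ω, c ω ^ 2 ∂η := integral_nonneg fun ω => sq_nonneg _
  refine ⟨(1 + t) * R, (1 + t⁻¹) * ∫ ω, c ω ^ 2 ∂η, by positivity, by nlinarith, by positivity,
    fun A B f g φ hg1 hgK M => ?_⟩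
  have hgc : Continuous g := continuous_of_dist_le_rpow hα fun u v => by
    rw [dist_eq_norm]; exact hgK u v
  have hgF : ∀ s, Continuous fun x => g x * M.F s x := fun s => hgc.mul (M.continuous_F hα s)
  have hgle : ∀ s x, ‖g x * M.F s x‖ ≤ M.ρ s x := fun s x => by
    rw [norm_mul]
    exact (mul_le_of_le_one_left (norm_nonneg _) (hg1 x)).trans (M.norm_le s x)
  have hgH : ∀ s, HolderBy α (M.a s + K) (fun x => g x * M.F s x) (M.ρ s) := by
    intro s u v
    have h1 : g u * M.F s u - g v * M.F s v
        = g u * (M.F s u - M.F s v) + (g u - g v) * M.F s v := by ring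
    have hd : 0 ≤ dist u v ^ α := Real.rpow_nonneg dist_nonneg _
    calc ‖g u * M.F s u - g v * M.F s v‖
        ≤ ‖M.F s u - M.F s v‖ + K * dist u v ^ α * ‖M.F s v‖ := by
          rw [h1]
          refine (norm_add_le _ _).trans (add_le_add ?_ ?_)
          · rw [norm_mul]
            exact mul_le_of_le_one_left (norm_nonneg _) (hg1 u)
          · rw [norm_mul]
            gcongr
            exact hgK u v
      _ ≤ M.a s * dist u v ^ α * (M.ρ s u + M.ρ s v)
          + K * dist u v ^ α * (M.ρ s u + M.ρ s v) := by
          gcongr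
          · exact M.holder s u v
          · exact (M.norm_le s v).trans (le_add_of_nonneg_left (M.ρ_nonneg s u))
      _ = (M.a s + K) * dist u v ^ α * (M.ρ s u + M.ρ s v) := by ring
  have hFm : StronglyMeasurable fun p : M.S × UnitAddCircle => g p.2 * M.F p.1 p.2 :=
    (hgc.stronglyMeasurable.comp_measurable measurable_snd).mul M.measurable_F
  have hmomA := integrable_sq_add_and_integral_le (η := η) (ν := M.ν) hlαm hcm M.measurable_a
    hli hc2 M.integrable_a ht0
  have hmomB := integrable_sq_add_and_integral_le (η := η) (ν := M.ν) hlm hDm M.measurable_b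
    h.integrable_dilation h.integrable_distortion M.integrable_b ht0
  have ha0 : 0 ≤ ∫ s, M.a s ^ 2 ∂M.ν := integral_nonneg fun _ => sq_nonneg _
  have hb0 : 0 ≤ ∫ s, M.b s ^ 2 ∂M.ν := integral_nonneg fun _ => sq_nonneg _
  have hFm' := stronglyMeasurable_transfer h.measurable h.isC2 hFm hgF
  have hρm' := stronglyMeasurable_transfer h.measurable h.isC2 M.measurable_ρ M.continuous_ρ
  have hb'0 : ∀ p : Ω × M.S, 0 ≤ l p.1 * M.b p.2 + distortion (T p.1) := fun p =>
    add_nonneg (mul_nonneg (hl0 _) (M.b_nonneg _)) (distortion_nonneg _)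
  have hρ'int : ∀ p : Ω × M.S, ∫ x, transfer (T p.1) (M.ρ p.2) x = 1 := fun p =>
    ((h.isC2 _).integral_transfer (integrable_of_continuous (M.continuous_ρ _))).trans
      (M.integral_ρ _)
  have hρ'int2 : ∀ x, Integrable (fun p : Ω × M.S => transfer (T p.1) (M.ρ p.2) x)
      (η.prod M.ν) := by
    intro x
    refine ((integrable_const 3).add hmomB.1).mono'
      (hρm'.comp_measurable (measurable_id.prodMk measurable_const)).aestronglyMeasurable
      (Eventually.of_forall fun p => ?_)
    have h0 := (h.isC2 p.1).transfer_nonneg (M.ρ_nonneg p.2)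
    have h1 := ((M.logLip p.2).transfer (h.isC2 p.1) (M.b_nonneg _)
      (M.ρ_nonneg _)).le_of_integral_eq_one (hb'0 p) h0
      (integrable_of_continuous ((h.isC2 _).continuous_transfer (M.continuous_ρ _)))
      (hρ'int p) x
    rw [Real.norm_of_nonneg (h0 x)]
    simp only [Pi.add_apply]
    nlinarith [sq_nonneg (l p.1 * M.b p.2 + distortion (T p.1) - 1)]
  have hF'int : ∀ x, Integrable
      (fun p : Ω × M.S => transfer (T p.1) (fun y => g y * M.F p.2 y) x) (η.prod M.ν) :=
    fun x => (hρ'int2 x).mono'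
      (hFm'.comp_measurable (measurable_id.prodMk measurable_const)).aestronglyMeasurable
      (Eventually.of_forall fun p => (h.isC2 _).norm_transfer_le (hgle _) x)
  -- The new component space records the new map together with the old component; the product
  -- measure expresses their independence.
  exact ⟨{
    S := Ω × M.S
    mS := inferInstance
    ν := η.prod M.ν
    prob := inferInstance
    F := fun p => transfer (T p.1) fun x => g x * M.F p.2 x
    ρ := fun p => transfer (T p.1) (M.ρ p.2)
    a := fun p => l p.1 ^ α * M.a p.2 + c p.1
    b := fun p => l p.1 * M.b p.2 + distortion (T p.1)
    measurable_F := hFm'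
    measurable_ρ := hρm'
    measurable_a := ((hlαm.comp measurable_fst).mul (M.measurable_a.comp measurable_snd)).add
      (hcm.comp measurable_fst)
    measurable_b := ((hlm.comp measurable_fst).mul (M.measurable_b.comp measurable_snd)).add
      (hDm.comp measurable_fst)
    a_nonneg := fun p => add_nonneg (mul_nonneg (Real.rpow_nonneg (hl0 _) _) (M.a_nonneg _))
      (add_nonneg (mul_nonneg (Real.rpow_nonneg (hl0 _) _) hK) (distortion_nonneg _))
    b_nonneg := hb'0
    norm_le := fun p x => (h.isC2 _).norm_transfer_le (hgle p.2) x
    holder := fun p => by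
      have h1 := (hgH p.2).transfer (h.isC2 p.1) hα hα1 (add_nonneg (M.a_nonneg _) hK) (hgle p.2)
      rwa [mul_add, add_assoc] at h1
    logLip := fun p => (M.logLip p.2).transfer (h.isC2 _) (M.b_nonneg _) (M.ρ_nonneg _)
    integral_ρ := hρ'int
    integrable_a := hmomA.1
    integrable_b := hmomB.1
    moment_a := hmomA.2.trans (by
      have h1 := M.moment_a
      gcongr)
    moment_b := hmomB.2.trans (by
      have h1 := M.moment_b
      gcongr)
    f_eq := fun x => by
      rw [integral_prod _ (hF'int x), avgTransfer]
      congr 1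
      funext ω
      -- For fixed `ω` the transfer is a finite sum over the fibre, so it commutes with averaging
      -- over components.
      obtain ⟨d, p, v, -, -, hsum⟩ := (h.isC2 ω).exists_transfer_eq_sum x
      simp_rw [hsum]
      rw [integral_finsetSum _ (f := fun j s => v j • (g (p j) * M.F s (p j))) fun j _ =>
        (((M.integrable_F (p j)).const_mul (g (p j))).smul (v j))]
      refine Finset.sum_congr rfl fun j _ => ?_
      rw [integral_smul, integral_const_mul, M.f_eq]
    φ_eq := fun x => by
      rw [integral_prod _ (hρ'int2 x), avgTransfer]
      congr 1
      funext ω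
      obtain ⟨d, p, v, -, -, hsum⟩ := (h.isC2 ω).exists_transfer_eq_sum x
      simp_rw [hsum]
      rw [integral_finsetSum _ (f := fun j s => v j • M.ρ s (p j)) fun j _ => ((M.integrable_ρ (p j)).smul (v j))]
      refine Finset.sum_congr rfl fun j _ => ?_
      rw [integral_smul, M.φ_eq] }⟩

end ExpandingOnAverage

end RandomCircle

/-! ### Convergence to the invariant density -/

namespace RandomCircle

open Filter Topology Set

universe u

variable {Ω : Type u} [MeasurableSpace Ω] {η : Measure Ω} {T : Ω → UnitAddCircle → UnitAddCircle}

/-- The evolution of a density `f` under alternating multiplication by the functions `u n` and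
application of the averaged transfer operator. -/
noncomputable def weightedEvolution (η : Measure Ω) (T : Ω → UnitAddCircle → UnitAddCircle)
    (u : ℕ → UnitAddCircle → ℂ) (f : UnitAddCircle → ℂ) : ℕ → UnitAddCircle → ℂ
  | 0 => f
  | n + 1 => avgTransfer η T fun x => u n x * weightedEvolution η T u f n x

/-- A probability density on the circle with log-Lipschitz constant `b`. -/
structure IsLogLipDensity (b : ℝ) (φ : UnitAddCircle → ℝ) : Prop where
  nonneg : ∀ x, 0 ≤ φ x
  logLip : LogLip b φ
  integral_eq : ∫ x, φ x = 1

theorem IsLogLipDensity.continuous {b : ℝ} {φ : UnitAddCircle → ℝ} (hφ : IsLogLipDensity b φ)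
    (hb : 0 ≤ b) : Continuous φ :=
  hφ.logLip.continuous hb hφ.nonneg

theorem IsLogLipDensity.mono {b b' : ℝ} {φ : UnitAddCircle → ℝ} (hφ : IsLogLipDensity b φ)
    (hb : b ≤ b') : IsLogLipDensity b' φ :=
  ⟨hφ.nonneg, fun u v => (hφ.logLip u v).trans (by
    have := hφ.nonneg v
    gcongr), hφ.integral_eq⟩

theorem isLogLipDensity_one : IsLogLipDensity 0 fun _ => (1 : ℝ) :=
  ⟨fun _ => zero_le_one, fun u v => by simp, by simp⟩

theorem IsLogLipDensity.le {b : ℝ} {φ : UnitAddCircle → ℝ} (hφ : IsLogLipDensity b φ)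
    (hb : 0 ≤ b) (x : UnitAddCircle) : φ x ≤ 2 * (1 + b) :=
  hφ.logLip.le_of_integral_eq_one hb hφ.nonneg (integrable_of_continuous (hφ.continuous hb))
    hφ.integral_eq x

theorem integral_abs_sub_le {φ ψ : UnitAddCircle → ℝ} (hφc : Continuous φ) (hψc : Continuous ψ)
    (hφ : ∀ x, 0 ≤ φ x) (hψ : ∀ x, 0 ≤ ψ x) :
    ∫ x, |φ x - ψ x| ≤ (∫ x, φ x) + ∫ x, ψ x := by
  rw [← integral_add (integrable_of_continuous hφc) (integrable_of_continuous hψc)]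
  refine integral_mono (integrable_of_continuous (hφc.sub hψc).abs)
    (integrable_of_continuous (hφc.add hψc)) fun x => ?_
  exact abs_le.2 ⟨by linarith [hφ x, hψ x], by linarith [hφ x, hψ x]⟩

/-- A Hölder function is approximated at scale `δ` by a Lipschitz function, its
inf-convolution. -/
theorem exists_lipschitz_approx {f : UnitAddCircle → ℝ} {α K δ : ℝ} (hα : 0 < α) (hα1 : α ≤ 1)
    (hK : 0 ≤ K) (hδ : 0 < δ) (hf : ∀ u v, |f u - f v| ≤ K * dist u v ^ α) :
    ∃ g : UnitAddCircle → ℝ, (∀ u v, |g u - g v| ≤ K * δ ^ (α - 1) * dist u v) ∧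
      ∀ x, |f x - g x| ≤ K * δ ^ α := by
  set L : ℝ := K * δ ^ (α - 1) with hL
  have hL0 : 0 ≤ L := by positivity
  -- Within distance `δ` the Hölder error is at most `K δ^α`; beyond it the cone of slope `L`
  -- dominates the Hölder modulus.
  have key : ∀ x y, f x - K * δ ^ α ≤ f y + L * dist x y := by
    intro x y
    have h1 := (abs_le.1 (hf x y)).2
    have hpow : δ ^ α = δ ^ (α - 1) * δ := by
      rw [Real.rpow_sub_one hδ.ne']
      field_simp
    rcases le_total (dist x y) δ with hd | hd
    · have h2 : dist x y ^ α ≤ δ ^ α := Real.rpow_le_rpow dist_nonneg hd hα.le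
      have h3 : K * dist x y ^ α ≤ K * δ ^ α := by gcongr
      have h4 : 0 ≤ L * dist x y := by positivity
      linarith
    · have hd0 : 0 < dist x y := hδ.trans_le hd
      have h2 : dist x y ^ (α - 1) ≤ δ ^ (α - 1) :=
        Real.rpow_le_rpow_of_nonpos hδ hd (by linarith)
      have h3 : dist x y ^ α = dist x y ^ (α - 1) * dist x y := by
        rw [Real.rpow_sub_one hd0.ne']
        field_simp
      have h4 : K * dist x y ^ α ≤ L * dist x y := by
        rw [h3, hL, ← mul_assoc]
        gcongr
      have h5 : 0 ≤ K * δ ^ α := by positivity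
      linarith
  have hbdd : ∀ x, BddBelow (range fun y => f y + L * dist x y) := fun x =>
    ⟨f x - K * δ ^ α, by rintro _ ⟨y, rfl⟩; exact key x y⟩
  refine ⟨fun x => ⨅ y, (f y + L * dist x y), ?_, fun x => ?_⟩
  · have h1 : ∀ u v, (⨅ y, (f y + L * dist u y)) - L * dist u v ≤ ⨅ y, (f y + L * dist v y) := by
      intro u v
      refine le_ciInf fun y => ?_
      have h2 := ciInf_le (hbdd u) y
      have h3 := mul_le_mul_of_nonneg_left (dist_triangle u v y) hL0
      linarith
    intro u v
    have h2 := h1 u v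
    have h3 := h1 v u
    rw [dist_comm v u] at h3
    exact abs_le.2 ⟨by linarith, by linarith⟩
  · have h1 := ciInf_le (hbdd x) x
    simp only [dist_self, mul_zero, add_zero] at h1
    have h2 : f x - K * δ ^ α ≤ ⨅ y, (f y + L * dist x y) := le_ciInf (key x)
    have h5 : 0 ≤ K * δ ^ α := by positivity
    exact abs_le.2 ⟨by linarith, by linarith⟩

/-- The factor `r⁻¹` pays for rounding `n / N` down. -/
theorem exists_pow_div_le {r : ℝ} (hr : 0 < r) (hr1 : r < 1) {N : ℕ} (hN : 0 < N) :
    ∃ τ C : ℝ, 0 < τ ∧ τ < 1 ∧ 0 < C ∧ ∀ n : ℕ, r ^ (n / N) ≤ C * τ ^ n := by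
  have hN' : (0 : ℝ) < N := by exact_mod_cast hN
  refine ⟨r ^ (1 / (N : ℝ)), r⁻¹, by positivity, Real.rpow_lt_one hr.le hr1 (by positivity),
    by positivity, fun n => ?_⟩
  rw [← Real.rpow_natCast (r ^ (1 / (N : ℝ))), ← Real.rpow_mul hr.le, ← Real.rpow_neg_one,
    ← Real.rpow_add hr, ← Real.rpow_natCast]
  refine Real.rpow_le_rpow_of_exponent_ge hr hr1.le ?_
  have h1 : (n : ℝ) < N * ((n / N : ℕ) + 1) := by
    exact_mod_cast Nat.lt_mul_div_succ n hN
  have h2 : 1 / (N : ℝ) * n ≤ (n / N : ℕ) + 1 := by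
    rw [one_div, inv_mul_le_iff₀ hN']
    exact h1.le
  linarith

namespace ExpandingOnAverage

variable (h : ExpandingOnAverage η T) [IsProbabilityMeasure η] {α : ℝ}

include h

/-- Iterating the moment recursion, whose fixed point is `C / (1 - q)`. The constants depend on the
multipliers only through `K`, hence are uniform in their number. -/
theorem exists_mixture_weightedEvolution (hα : 0 < α) (hα1 : α ≤ 1) {K : ℝ} (hK : 0 ≤ K) :
    ∃ q C : ℝ, 0 ≤ q ∧ q < 1 ∧ 0 ≤ C ∧ ∀ (A B : ℝ) (f : UnitAddCircle → ℂ)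
      (u : ℕ → UnitAddCircle → ℂ) (φ : UnitAddCircle → ℝ), (∀ n x, ‖u n x‖ ≤ 1) →
      (∀ n x y, ‖u n x - u n y‖ ≤ K * dist x y ^ α) → Mixture.{u} α A B f φ → ∀ n : ℕ,
      Nonempty (Mixture.{u} α (q ^ n * A + C) (q ^ n * B + C) (weightedEvolution η T u f n)
        ((avgTransfer η T)^[n] φ)) := by
  obtain ⟨q, C, hq0, hq1, hC, hstep⟩ := h.exists_mixture_step hα hα1 hK
  have h1q : 0 < 1 - q := by linarith
  refine ⟨q, C / (1 - q), hq0, hq1, by positivity, fun A B f u φ hu1 huK M n => ?_⟩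
  have hC' : 0 ≤ C / (1 - q) := by positivity
  induction n with
  | zero => exact ⟨M.mono (by simpa using hC') (by simpa using hC')⟩
  | succ n ih =>
    obtain ⟨M'⟩ := ih
    obtain ⟨M''⟩ := hstep _ _ _ (u n) _ (hu1 n) (huK n) M'
    rw [Function.iterate_succ_apply']
    have hfix : q * (C / (1 - q)) + C = C / (1 - q) := by
      field_simp
      ring
    have h1 : ∀ A, q * (q ^ n * A + C / (1 - q)) + C = q ^ (n + 1) * A + C / (1 - q) := by
      intro A
      rw [mul_add, add_assoc, hfix, pow_succ]
      ring
    exact ⟨M''.mono (h1 A).le (h1 B).le⟩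

theorem continuous_iterate {E : Type} [NormedAddCommGroup E] [NormedSpace ℝ E] [CompleteSpace E]
    {f : UnitAddCircle → E} (hf : Continuous f) (n : ℕ) :
    Continuous ((avgTransfer η T)^[n] f) := by
  induction n with
  | zero => exact hf
  | succ n ih =>
    rw [Function.iterate_succ_apply']
    exact h.continuous_avgTransfer ih

theorem iterate_linear {f g : UnitAddCircle → ℝ} (hf : Continuous f) (hg : Continuous g)
    (a b : ℝ) (n : ℕ) :
    (avgTransfer η T)^[n] (fun x => a * f x + b * g x) =
      fun x => a * (avgTransfer η T)^[n] f x + b * (avgTransfer η T)^[n] g x := by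
  induction n with
  | zero => rfl
  | succ n ih =>
    have hf' := h.continuous_iterate hf n
    have hg' := h.continuous_iterate hg n
    simp only [Function.iterate_succ_apply', ih]
    rw [h.avgTransfer_add (f := fun x => a * (avgTransfer η T)^[n] f x)
      (g := fun x => b * (avgTransfer η T)^[n] g x) (continuous_const.mul hf')
      (continuous_const.mul hg'), h.avgTransfer_const_mul hf', h.avgTransfer_const_mul hg']

theorem iterate_clm {E F : Type} [NormedAddCommGroup E] [NormedSpace ℝ E] [CompleteSpace E]
    [NormedAddCommGroup F] [NormedSpace ℝ F] [CompleteSpace F] {f : UnitAddCircle → E}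
    (hf : Continuous f) (l : E →L[ℝ] F) (n : ℕ) :
    (avgTransfer η T)^[n] (fun x => l (f x)) = fun x => l ((avgTransfer η T)^[n] f x) := by
  induction n with
  | zero => rfl
  | succ n ih =>
    simp only [Function.iterate_succ_apply', ih]
    rw [h.avgTransfer_clm (h.continuous_iterate hf n)]

theorem integral_iterate {𝕜 : Type} [RCLike 𝕜] {f : UnitAddCircle → 𝕜} (hf : Continuous f)
    (n : ℕ) : ∫ x, (avgTransfer η T)^[n] f x = ∫ x, f x := by
  induction n with
  | zero => rfl
  | succ n ih => rw [Function.iterate_succ_apply', h.integral_avgTransfer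
      (h.continuous_iterate hf n), ih]

theorem integral_norm_iterate_le {f : UnitAddCircle → ℝ} (hf : Continuous f) (n : ℕ) :
    ∫ x, |(avgTransfer η T)^[n] f x| ≤ ∫ x, |f x| := by
  induction n with
  | zero => exact le_rfl
  | succ n ih =>
    rw [Function.iterate_succ_apply']
    exact (h.integral_norm_avgTransfer_le (h.continuous_iterate hf n)).trans ih

/-- The mixture bounds for `φ` alone, with zero as complex component, exponent one and trivial
multipliers. Once `q^n b² ≤ 1` the initial regularity is forgotten and the constants no longer
involve `b`. -/
theorem exists_density_regularity :
    ∃ q C : ℝ, 0 ≤ q ∧ q < 1 ∧ 0 ≤ C ∧ ∀ (b : ℝ) (φ : UnitAddCircle → ℝ), 0 ≤ b →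
      IsLogLipDensity b φ → ∀ n : ℕ, q ^ n * b ^ 2 ≤ 1 →
      (∀ u v, |(avgTransfer η T)^[n] φ u - (avgTransfer η T)^[n] φ v| ≤ (4 + 3 * C) * dist u v) ∧
      ∀ x, Real.exp (-(2 + C)) ≤ (avgTransfer η T)^[n] φ x := by
  obtain ⟨q, C, hq0, hq1, hC, hmix⟩ :=
    h.exists_mixture_weightedEvolution one_pos le_rfl (le_refl (0 : ℝ))
  refine ⟨q, C, hq0, hq1, hC, fun b φ hb hφ n hn => ?_⟩
  have M0 : Mixture.{u} 1 (0 ^ 2) (b ^ 2) (fun _ => 0) φ :=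
    Mixture.single le_rfl hb continuous_const (fun x => by simpa using hφ.nonneg x)
      (fun u v => by simp) hφ.logLip hφ.integral_eq
  obtain ⟨M⟩ := hmix _ _ _ (fun _ _ => 1) _ (by simp) (by simp) M0 n
  refine ⟨fun u v => (M.abs_φ_sub_le u v).trans ?_, fun x => le_trans ?_ (M.exp_neg_le_φ x)⟩
  · gcongr ?_ * _
    linarith
  · refine Real.exp_le_exp.2 ?_
    linarith

/-- After finitely many steps, the difference of two regular densities is a definite factor times
the difference of two densities of the same regularity. -/
theorem exists_coupling :
    ∃ κ b₀ : ℝ, 0 < κ ∧ κ < 1 ∧ 1 ≤ b₀ ∧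
      (∀ n, (IsLogLipDensity b₀ ((avgTransfer η T)^[n] fun _ => (1 : ℝ)))) ∧
      ∀ b, b₀ ≤ b → ∃ N : ℕ, 0 < N ∧ ∀ f g : UnitAddCircle → ℝ,
        IsLogLipDensity b f → IsLogLipDensity b g → ∃ f' g' : UnitAddCircle → ℝ,
          IsLogLipDensity b f' ∧ IsLogLipDensity b g' ∧
          ∀ x, (avgTransfer η T)^[N] f x - (avgTransfer η T)^[N] g x
            = (1 - κ) * (f' x - g' x) := by
  obtain ⟨q, C, hq0, hq1, hC, hreg⟩ := h.exists_density_regularity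
  -- Half of the lower bound: removing `κ` leaves a function still at least `κ`, which keeps its
  -- log-Lipschitz constant at most `(4 + 3 * C) / κ`.
  set κ : ℝ := Real.exp (-(2 + C)) / 2 with hκ
  have hκ0 : 0 < κ := by positivity
  have hκ1 : κ < 1 / 2 := by
    have : Real.exp (-(2 + C)) < 1 := Real.exp_lt_one_iff.2 (by linarith)
    linarith
  have h2κ : Real.exp (-(2 + C)) = 2 * κ := by rw [hκ]; ring
  have hL0 : 0 ≤ 4 + 3 * C := by positivity
  have hb₀ : 1 ≤ (4 + 3 * C) / κ := by
    rw [le_div_iff₀ hκ0]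
    linarith
  refine ⟨κ, (4 + 3 * C) / κ, hκ0, by linarith, hb₀, fun n => ?_, fun b hb => ?_⟩
  · obtain ⟨h1, h2⟩ := hreg 0 _ le_rfl isLogLipDensity_one n (by simp)
    rw [h2κ] at h2
    refine ⟨fun x => (by positivity : (0 : ℝ) ≤ 2 * κ).trans (h2 x),
      logLip_of_abs_sub_le hL0 hκ0 (fun x => le_trans (by linarith) (h2 x)) h1, ?_⟩
    rw [h.integral_iterate continuous_const]
    simp
  · have hb0 : 0 ≤ b := by linarith
    obtain ⟨N, hN⟩ := ((tendsto_pow_atTop_nhds_zero_of_lt_one hq0 hq1).mul_const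
      (b ^ 2)).eventually (ge_mem_nhds (show (0 : ℝ) * b ^ 2 < 1 by simp)) |>.exists_forall_of_atTop
    refine ⟨N + 1, N.succ_pos, fun f g hf hg => ?_⟩
    have key : ∀ f, IsLogLipDensity b f →
        IsLogLipDensity b fun x => ((avgTransfer η T)^[N + 1] f x - κ) / (1 - κ) := by
      intro f hf
      obtain ⟨h1, h2⟩ := hreg b f hb0 hf (N + 1) (hN _ N.le_succ)
      rw [h2κ] at h2
      have hc := h.continuous_iterate (hf.continuous hb0) (N + 1)
      have hκ' : 0 < 1 - κ := by linarith
      -- Division by `1 - κ` restores total mass one; it cancels in the quotient of Lipschitz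
      -- constant and lower bound.
      refine IsLogLipDensity.mono ⟨fun x => div_nonneg (by linarith [h2 x]) hκ'.le,
        logLip_of_abs_sub_le (L := (4 + 3 * C) / (1 - κ)) (c := κ / (1 - κ)) (by positivity)
          (by positivity) (fun x => ?_) (fun u v => ?_), ?_⟩ (le_trans (le_of_eq ?_) hb)
      · gcongr
        linarith [h2 x]
      · rw [← sub_div, abs_div, abs_of_pos hκ', sub_sub_sub_cancel_right, div_mul_eq_mul_div]
        gcongr
        exact h1 u v
      · rw [integral_div, integral_sub (integrable_of_continuous hc) (integrable_const _),
          h.integral_iterate (hf.continuous hb0), hf.integral_eq]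
        simp only [integral_const, probReal_univ, smul_eq_mul, one_mul]
        exact div_self hκ'.ne'
      · field_simp
    refine ⟨_, _, key f hf, key g hg, fun x => ?_⟩
    have hκ' : 1 - κ ≠ 0 := by linarith
    field_simp
    ring

/-- The contraction of `exists_coupling`, iterated. -/
theorem iterate_coupling {κ b : ℝ} {N : ℕ} (hb : 0 ≤ b)
    (hN : ∀ f g : UnitAddCircle → ℝ, IsLogLipDensity b f → IsLogLipDensity b g →
      ∃ f' g' : UnitAddCircle → ℝ, IsLogLipDensity b f' ∧ IsLogLipDensity b g' ∧
        ∀ x, (avgTransfer η T)^[N] f x - (avgTransfer η T)^[N] g x = (1 - κ) * (f' x - g' x))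
    (k : ℕ) {f g : UnitAddCircle → ℝ} (hf : IsLogLipDensity b f) (hg : IsLogLipDensity b g) :
    ∃ f' g' : UnitAddCircle → ℝ, IsLogLipDensity b f' ∧ IsLogLipDensity b g' ∧
      ∀ x, (avgTransfer η T)^[N * k] f x - (avgTransfer η T)^[N * k] g x
        = (1 - κ) ^ k * (f' x - g' x) := by
  induction k with
  | zero => exact ⟨f, g, hf, hg, fun x => by simp⟩
  | succ k ih =>
    obtain ⟨f', g', hf', hg', heq⟩ := ih
    obtain ⟨f'', g'', hf'', hg'', heq'⟩ := hN f' g' hf' hg'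
    refine ⟨f'', g'', hf'', hg'', fun x => ?_⟩
    have hfc := h.continuous_iterate (hf.continuous hb) (N * k)
    have hgc := h.continuous_iterate (hg.continuous hb) (N * k)
    have h1 : (fun x => 1 * (avgTransfer η T)^[N * k] f x + (-1) * (avgTransfer η T)^[N * k] g x)
        = fun x => (1 - κ) ^ k * f' x + (-(1 - κ) ^ k) * g' x := by
      funext x
      linarith [heq x]
    have h2 := congrFun (h.iterate_linear hfc hgc 1 (-1) N) x
    rw [h1, h.iterate_linear (hf'.continuous hb) (hg'.continuous hb)] at h2
    rw [Nat.mul_succ, add_comm (N * k), Function.iterate_add_apply, Function.iterate_add_apply,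
      pow_succ, mul_assoc, ← heq']
    linarith

/-- The coupling handles `N * (n / N)` steps; the remaining `n % N` steps do not increase the `L¹`
norm. -/
theorem integral_abs_iterate_sub_le {κ b : ℝ} {N : ℕ} (hb : 0 ≤ b) (hκ : κ ≤ 1)
    (hN : ∀ f g : UnitAddCircle → ℝ, IsLogLipDensity b f → IsLogLipDensity b g →
      ∃ f' g' : UnitAddCircle → ℝ, IsLogLipDensity b f' ∧ IsLogLipDensity b g' ∧
        ∀ x, (avgTransfer η T)^[N] f x - (avgTransfer η T)^[N] g x = (1 - κ) * (f' x - g' x))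
    (n : ℕ) {f g : UnitAddCircle → ℝ} (hf : IsLogLipDensity b f) (hg : IsLogLipDensity b g) :
    ∫ x, |(avgTransfer η T)^[n] f x - (avgTransfer η T)^[n] g x| ≤ 2 * (1 - κ) ^ (n / N) := by
  obtain ⟨f', g', hf', hg', heq⟩ := h.iterate_coupling hb hN (n / N) hf hg
  have hfc := h.continuous_iterate (hf.continuous hb) (N * (n / N))
  have hgc := h.continuous_iterate (hg.continuous hb) (N * (n / N))
  have hκ' : 0 ≤ (1 - κ) ^ (n / N) := pow_nonneg (by linarith) _
  have h1 := h.iterate_linear hfc hgc 1 (-1) (n % N)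
  simp only [← Function.iterate_add_apply, Nat.mod_add_div] at h1
  have h2 := h.integral_norm_iterate_le (f := fun x => 1 * (avgTransfer η T)^[N * (n / N)] f x
    + (-1) * (avgTransfer η T)^[N * (n / N)] g x)
    ((continuous_const.mul hfc).add (continuous_const.mul hgc)) (n % N)
  rw [h1] at h2
  simp only [one_mul, neg_one_mul, ← sub_eq_add_neg] at h2
  refine h2.trans ?_
  simp_rw [heq, abs_mul, abs_of_nonneg hκ', integral_const_mul]
  have h3 := integral_abs_sub_le (hf'.continuous hb) (hg'.continuous hb) hf'.nonneg hg'.nonneg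
  rw [hf'.integral_eq, hg'.integral_eq] at h3
  nlinarith

/-- The iterates of the constant one form a Cauchy sequence at each point, by coupling a later
iterate with the constant one itself. The uniform Lipschitz and lower bounds pass to the pointwise
limit, and dominated convergence gives invariance. -/
theorem exists_invariant_density :
    ∃ φ : UnitAddCircle → ℝ, (∃ L : ℝ, 0 ≤ L ∧ ∀ u v, |φ u - φ v| ≤ L * dist u v) ∧
      (∃ c > 0, ∀ x, c ≤ φ x) ∧ ∫ x, φ x = 1 ∧ avgTransfer η T φ = φ := by
  obtain ⟨q, C, -, -, hC, hreg⟩ := h.exists_density_regularity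
  obtain ⟨κ, b, hκ0, hκ1, hb1, hone, hcpl⟩ := h.exists_coupling
  have hb : 0 ≤ b := by linarith
  obtain ⟨N, hN0, hN⟩ := hcpl b le_rfl
  set a : ℕ → UnitAddCircle → ℝ := fun n => (avgTransfer η T)^[n] fun _ => (1 : ℝ) with ha
  have hac : ∀ n, Continuous (a n) := fun n => h.continuous_iterate continuous_const n
  have hale : ∀ n x, ‖a n x‖ ≤ 2 * (1 + b) := fun n x => by
    rw [Real.norm_of_nonneg ((hone n).nonneg x)]
    exact (hone n).le hb x
  have hclose : ∀ k m x, N * k ≤ m → |a m x - a (N * k) x| ≤ (1 - κ) ^ k * (2 * (1 + b)) := by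
    intro k m x hm
    obtain ⟨j, rfl⟩ := Nat.exists_eq_add_of_le hm
    obtain ⟨f', g', hf', hg', heq⟩ := h.iterate_coupling hb hN k (hone j) (hone 0)
    have h1 := heq x
    rw [← Function.iterate_add_apply, ← Function.iterate_add_apply, add_zero] at h1
    change |(avgTransfer η T)^[N * k + j] (fun _ => (1 : ℝ)) x - _| ≤ _
    have hκ' : 0 ≤ (1 - κ) ^ k := pow_nonneg (by linarith) _
    rw [h1, abs_mul, abs_of_nonneg hκ']
    gcongr
    exact abs_le.2 ⟨by linarith [hf'.nonneg x, hg'.le hb x], by linarith [hg'.nonneg x, hf'.le hb x]⟩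
  have hcau : ∀ x, CauchySeq fun n => a n x := by
    intro x
    rw [Metric.cauchySeq_iff']
    intro ε hε
    have ht : Tendsto (fun k : ℕ => (1 - κ) ^ k * (2 * (1 + b))) atTop (𝓝 (0 * (2 * (1 + b)))) :=
      (tendsto_pow_atTop_nhds_zero_of_lt_one (by linarith) (by linarith)).mul_const _
    rw [zero_mul] at ht
    obtain ⟨k, hk⟩ := (ht.eventually (gt_mem_nhds hε)).exists
    exact ⟨N * k, fun m hm => (hclose k m x hm).trans_lt hk⟩
  choose φ hφ using fun x => cauchySeq_tendsto_of_complete (hcau x)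
  have hreg' := fun n => hreg 0 _ le_rfl isLogLipDensity_one n (by simp)
  have hL : ∀ u v, |φ u - φ v| ≤ (4 + 3 * C) * dist u v := fun u v =>
    le_of_tendsto ((hφ u).sub (hφ v)).abs (Eventually.of_forall fun n => (hreg' n).1 u v)
  refine ⟨φ, ⟨4 + 3 * C, by positivity, hL⟩, ⟨_, Real.exp_pos (-(2 + C)), fun x =>
    ge_of_tendsto (hφ x) (Eventually.of_forall fun n => (hreg' n).2 x)⟩, ?_, ?_⟩
  · have h1 : Tendsto (fun n => ∫ x, a n x) atTop (𝓝 (∫ x, φ x)) :=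
      tendsto_integral_of_dominated_convergence (fun _ => 2 * (1 + b))
        (fun n => (hac n).aestronglyMeasurable) (integrable_const _)
        (fun n => Eventually.of_forall (hale n)) (Eventually.of_forall hφ)
    exact tendsto_nhds_unique h1 (tendsto_const_nhds.congr fun n => (hone n).integral_eq.symm)
  · funext x
    have h1 : Tendsto (fun n => avgTransfer η T (a n) x) atTop (𝓝 (avgTransfer η T φ x)) := by
      refine tendsto_integral_of_dominated_convergence
        (fun ω => (2 * (1 + b)) * (2 * (1 + distortion (T ω))))
        (fun n => (h.integrable_transfer (hac n) x).aestronglyMeasurable)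
        (h.integrable_bound _)
        (fun n => Eventually.of_forall fun ω =>
          (h.isC2 ω).norm_transfer_le_const (by positivity) (hale n) x)
        (Eventually.of_forall fun ω => ?_)
      obtain ⟨d, p, v, -, -, hsum⟩ := (h.isC2 ω).exists_transfer_eq_sum x
      simp_rw [hsum]
      exact tendsto_finsetSum _ fun j _ => (hφ (p j)).const_smul (v j)
    refine tendsto_nhds_unique h1 (((hφ x).comp (tendsto_add_atTop_nat 1)).congr fun n => ?_)
    simp only [ha, Function.comp, Function.iterate_succ_apply']

/-- Exponential convergence to the invariant density for Lipschitz initial data. -/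
theorem exists_decay_lipschitz {φ : UnitAddCircle → ℝ} {L c : ℝ} (hL : 0 ≤ L) (hc : 0 < c)
    (hφL : ∀ u v, |φ u - φ v| ≤ L * dist u v) (hφc : ∀ x, c ≤ φ x) (hφ1 : ∫ x, φ x = 1)
    (hφ : avgTransfer η T φ = φ) :
    ∃ τ C : ℝ, 0 < τ ∧ τ < 1 ∧ 0 < C ∧ ∀ (f : UnitAddCircle → ℝ) (s K : ℝ), 0 ≤ K →
      (∀ x, |f x| ≤ s) → (∀ u v, |f u - f v| ≤ K * dist u v) → ∀ n : ℕ,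
      ∫ x, |(avgTransfer η T)^[n] f x - (∫ y, f y) * φ x| ≤ C * (1 + s + K) * τ ^ n := by
  obtain ⟨κ, b₀, hκ0, hκ1, hb1, hone, hcpl⟩ := h.exists_coupling
  -- Large enough for the invariant density to belong to the class on which the coupling acts.
  set b : ℝ := max b₀ (L / c) with hbdef
  have hbb : 1 ≤ b := hb1.trans (le_max_left _ _)
  have hb : 0 ≤ b := by linarith
  obtain ⟨N, hN0, hN⟩ := hcpl b (le_max_left _ _)
  obtain ⟨τ, C, hτ0, hτ1, hC, hpow⟩ := exists_pow_div_le (r := 1 - κ) (by linarith)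
    (by linarith) hN0
  have hφd : IsLogLipDensity b φ :=
    IsLogLipDensity.mono ⟨fun x => hc.le.trans (hφc x), logLip_of_abs_sub_le hL hc hφc hφL, hφ1⟩
      (le_max_right _ _)
  have hφc' : Continuous φ := hφd.continuous hb
  have hφn : ∀ n, (avgTransfer η T)^[n] φ = φ := fun n => Function.iterate_fixed hφ n
  have hone' : IsLogLipDensity b fun _ => (1 : ℝ) := isLogLipDensity_one.mono hb
  have hdec : ∀ n f, IsLogLipDensity b f →
      ∫ x, |(avgTransfer η T)^[n] f x - φ x| ≤ 2 * (C * τ ^ n) := by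
    intro n f hf
    have h1 := h.integral_abs_iterate_sub_le hb hκ1.le hN n hf hφd
    rw [hφn] at h1
    exact h1.trans (by gcongr; exact hpow n)
  refine ⟨τ, 6 * C, hτ0, hτ1, by positivity, fun f s K hK hfs hfK n => ?_⟩
  have hs : 0 ≤ s := (abs_nonneg _).trans (hfs 0)
  have hfc : Continuous f := continuous_of_dist_le_rpow (α := 1) (K := K) one_pos fun u v => by
    rw [Real.rpow_one]; exact hfK u v
  have hfi := integrable_of_continuous hfc
  -- The shift makes `f + S` at least `1 + K`, so the log-Lipschitz constant of its normalization is
  -- at most `K / (1 + K) ≤ 1 ≤ b`, whatever `f` is.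
  set S : ℝ := 1 + s + K with hS
  have hflow : ∀ x, 1 + K ≤ f x + S := fun x => by linarith [(abs_le.1 (hfs x)).1]
  set Z : ℝ := (∫ x, f x) + S with hZ
  have hf1 : |∫ x, f x| ≤ s := by
    have h1 := norm_integral_le_of_norm_le_const (μ := (volume : Measure UnitAddCircle)) (f := f)
      (C := s) (Eventually.of_forall hfs)
    simpa using h1
  have hZ1 : 1 ≤ Z := by linarith [(abs_le.1 hf1).1]
  have hZ2 : Z ≤ 2 * S := by linarith [(abs_le.1 hf1).2]
  have hZ0 : 0 < Z := by linarith
  have hF : IsLogLipDensity b fun x => (f x + S) / Z := by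
    refine IsLogLipDensity.mono ⟨fun x => div_nonneg (by linarith [hflow x]) hZ0.le,
      logLip_of_abs_sub_le (L := K / Z) (c := (1 + K) / Z) (by positivity) (by positivity)
        (fun x => ?_) (fun u v => ?_), ?_⟩ (le_trans ?_ hbb)
    · exact div_le_div_of_nonneg_right (hflow x) hZ0.le
    · rw [← sub_div, abs_div, abs_of_pos hZ0, add_sub_add_right_eq_sub, div_mul_eq_mul_div]
      gcongr
      exact hfK u v
    · rw [integral_div, integral_add hfi (integrable_const _)]
      simp only [integral_const, probReal_univ, smul_eq_mul, one_mul]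
      exact div_self hZ0.ne'
    · rw [div_div_div_cancel_right₀ hZ0.ne', div_le_one (by positivity)]
      linarith
  have hFc := hF.continuous hb
  -- `f` is a combination of two densities of the class, with coefficients `Z` and `-S`, both
  -- controlled by `S`.
  have hlin : (avgTransfer η T)^[n] f = fun x => Z * (avgTransfer η T)^[n]
      (fun x => (f x + S) / Z) x + (-S) * (avgTransfer η T)^[n] (fun _ => (1 : ℝ)) x := by
    rw [← h.iterate_linear hFc continuous_const]
    congr 1
    funext x
    field_simp
    ring
  have hA := hdec n _ hF
  have hB := hdec n _ hone'
  have hAc := h.continuous_iterate hFc n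
  have hBc := h.continuous_iterate (f := fun _ => (1 : ℝ)) continuous_const n
  have hS0 : 0 ≤ S := by positivity
  have hAi : Integrable fun x =>
      Z * |(avgTransfer η T)^[n] (fun x => (f x + S) / Z) x - φ x| :=
    integrable_of_continuous (continuous_const.mul (hAc.sub hφc').abs)
  have hBi : Integrable fun x => S * |(avgTransfer η T)^[n] (fun _ => (1 : ℝ)) x - φ x| :=
    integrable_of_continuous (continuous_const.mul (hBc.sub hφc').abs)
  calc ∫ x, |(avgTransfer η T)^[n] f x - (∫ y, f y) * φ x|
      ≤ ∫ x, (Z * |(avgTransfer η T)^[n] (fun x => (f x + S) / Z) x - φ x|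
        + S * |(avgTransfer η T)^[n] (fun _ => (1 : ℝ)) x - φ x|) := by
        refine integral_mono
          (integrable_of_continuous
            ((h.continuous_iterate hfc n).sub (continuous_const.mul hφc')).abs)
          (hAi.add hBi) fun x => ?_
        simp only [hlin]
        have h1 : Z * (avgTransfer η T)^[n] (fun x => (f x + S) / Z) x
            + (-S) * (avgTransfer η T)^[n] (fun _ => (1 : ℝ)) x - (∫ y, f y) * φ x
            = Z * ((avgTransfer η T)^[n] (fun x => (f x + S) / Z) x - φ x)
            - S * ((avgTransfer η T)^[n] (fun _ => (1 : ℝ)) x - φ x) := by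
          rw [show ∫ y, f y = Z - S by rw [hZ]; ring]
          ring
        rw [h1]
        refine (abs_sub _ _).trans_eq ?_
        rw [abs_mul, abs_mul, abs_of_pos hZ0, abs_of_nonneg hS0]
    _ = Z * (∫ x, |(avgTransfer η T)^[n] (fun x => (f x + S) / Z) x - φ x|)
        + S * ∫ x, |(avgTransfer η T)^[n] (fun _ => (1 : ℝ)) x - φ x| := by
        rw [integral_add hAi hBi, integral_const_mul, integral_const_mul]
    _ ≤ (2 * S) * (2 * (C * τ ^ n)) + S * (2 * (C * τ ^ n)) := by gcongr
    _ = 6 * C * S * τ ^ n := by ring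

/-- Exponential convergence to the invariant density for real Hölder initial data. -/
theorem exists_decay_holder {φ : UnitAddCircle → ℝ} {L c : ℝ} (hL : 0 ≤ L) (hc : 0 < c)
    (hφL : ∀ u v, |φ u - φ v| ≤ L * dist u v) (hφc : ∀ x, c ≤ φ x) (hφ1 : ∫ x, φ x = 1)
    (hφ : avgTransfer η T φ = φ) :
    ∃ θ C : ℝ, 0 < θ ∧ θ < 1 ∧ 0 < C ∧ ∀ (α : ℝ), 0 < α → α < 1 →
      ∀ (f : UnitAddCircle → ℝ) (s K : ℝ), 0 ≤ K →
      (∀ x, |f x| ≤ s) → (∀ u v, |f u - f v| ≤ K * dist u v ^ α) → ∀ n : ℕ,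
      ∫ x, |(avgTransfer η T)^[n] f x - (∫ y, f y) * φ x|
        ≤ C * (1 + s + K) * θ ^ (α * (n : ℝ)) := by
  obtain ⟨τ, C, hτ0, hτ1, hC, hdec⟩ := h.exists_decay_lipschitz hL hc hφL hφc hφ1 hφ
  have hφcont : Continuous φ := continuous_of_dist_le_rpow (α := 1) (K := L) one_pos fun u v => by
    rw [Real.rpow_one]; exact hφL u v
  have hθ0 : 0 < √τ := Real.sqrt_pos.2 hτ0
  have hθ1 : √τ < 1 := by rw [Real.sqrt_lt' one_pos]; simpa using hτ1
  refine ⟨√τ, 2 + 2 * C, hθ0, hθ1, by positivity,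
    fun α hα hα1 f s K hK hfs hfK n => ?_⟩
  have hs : 0 ≤ s := (abs_nonneg _).trans (hfs 0)
  -- At this scale `τ^n = δ²`, which outweighs the cost `δ^(α - 1)` of the Lipschitz constant. All
  -- errors are `O(δ^α)`, that is `√τ^(α n)`, so the base does not depend on `α`.
  set δ : ℝ := √τ ^ n with hδ
  have hδ0 : 0 < δ := by positivity
  have hδ1 : δ ≤ 1 := pow_le_one₀ hθ0.le hθ1.le
  have hδτ : τ ^ n = δ ^ 2 := by
    rw [hδ, ← pow_mul, mul_comm n 2, pow_mul, Real.sq_sqrt hτ0.le]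
  have hδα : √τ ^ (α * (n : ℝ)) = δ ^ α := by
    rw [mul_comm, Real.rpow_mul hθ0.le, Real.rpow_natCast]
  obtain ⟨g, hgL, hfg⟩ := exists_lipschitz_approx hα hα1.le hK hδ0 hfK
  have hδα1 : δ ^ α ≤ 1 := Real.rpow_le_one hδ0.le hδ1 hα.le
  have hδα0 : 0 ≤ δ ^ α := by positivity
  have hgs : ∀ x, |g x| ≤ s + K := by
    intro x
    have h1 := abs_le.1 (hfg x)
    have h2 := abs_le.1 (hfs x)
    have h3 : K * δ ^ α ≤ K := mul_le_of_le_one_right hK hδα1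
    exact abs_le.2 ⟨by linarith, by linarith⟩
  have hfc : Continuous f := continuous_of_dist_le_rpow hα hfK
  have hgc : Continuous g :=
    continuous_of_dist_le_rpow (α := 1) (K := K * δ ^ (α - 1)) one_pos fun u v => by
      rw [Real.rpow_one]; exact hgL u v
  have hgdec := hdec g (s + K) (K * δ ^ (α - 1)) (by positivity) hgs hgL n
  have hfgi : ∫ x, |f x - g x| ≤ K * δ ^ α := by
    have h1 := integral_mono (μ := (volume : Measure UnitAddCircle))
      (integrable_of_continuous (hfc.sub hgc).abs) (integrable_const (K * δ ^ α)) hfg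
    simpa using h1
  have hlin := h.iterate_linear hfc hgc 1 (-1) n
  have hcontr := h.integral_norm_iterate_le (f := fun x => 1 * f x + (-1) * g x)
    ((continuous_const.mul hfc).add (continuous_const.mul hgc)) n
  rw [hlin] at hcontr
  simp only [one_mul, neg_one_mul, ← sub_eq_add_neg] at hcontr
  have hmean : |(∫ x, g x) - ∫ x, f x| ≤ K * δ ^ α := by
    rw [abs_sub_comm, ← integral_sub (integrable_of_continuous hfc) (integrable_of_continuous hgc)]
    exact (abs_integral_le_integral_abs).trans hfgi
  have hfn := h.continuous_iterate hfc n
  have hgn := h.continuous_iterate hgc n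
  have hi1 : Integrable fun x => |(avgTransfer η T)^[n] f x - (avgTransfer η T)^[n] g x| :=
    integrable_of_continuous (hfn.sub hgn).abs
  have hi2 : Integrable fun x => |(avgTransfer η T)^[n] g x - (∫ y, g y) * φ x| :=
    integrable_of_continuous (hgn.sub (continuous_const.mul hφcont)).abs
  have hi12 : Integrable fun x => |(avgTransfer η T)^[n] f x - (avgTransfer η T)^[n] g x|
      + |(avgTransfer η T)^[n] g x - (∫ y, g y) * φ x| := hi1.add hi2
  have hi3 : Integrable fun x => K * δ ^ α * φ x :=
    integrable_of_continuous (continuous_const.mul hφcont)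
  calc ∫ x, |(avgTransfer η T)^[n] f x - (∫ y, f y) * φ x|
      ≤ ∫ x, (|(avgTransfer η T)^[n] f x - (avgTransfer η T)^[n] g x|
        + |(avgTransfer η T)^[n] g x - (∫ y, g y) * φ x| + K * δ ^ α * φ x) := by
        refine integral_mono
          (integrable_of_continuous (hfn.sub (continuous_const.mul hφcont)).abs)
          (hi12.add hi3) fun x => ?_
        have hφx : 0 ≤ φ x := hc.le.trans (hφc x)
        have h1 : (avgTransfer η T)^[n] f x - (∫ y, f y) * φ x
            = ((avgTransfer η T)^[n] f x - (avgTransfer η T)^[n] g x)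
              + ((avgTransfer η T)^[n] g x - (∫ y, g y) * φ x)
              + ((∫ x, g x) - ∫ x, f x) * φ x := by ring
        simp only
        rw [h1]
        refine (abs_add_three _ _ _).trans ?_
        rw [abs_mul _ (φ x), abs_of_nonneg hφx]
        gcongr
    _ ≤ K * δ ^ α + C * (1 + (s + K) + K * δ ^ (α - 1)) * τ ^ n + K * δ ^ α := by
        rw [integral_add hi12 hi3, integral_add hi1 hi2, integral_const_mul, hφ1, mul_one]
        gcongr
        exact hcontr.trans hfgi
    _ ≤ (2 + 2 * C) * (1 + s + K) * √τ ^ (α * (n : ℝ)) := by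
        rw [hδα, hδτ]
        have h1 : δ ^ 2 ≤ δ ^ α := by
          rw [← Real.rpow_natCast]
          exact Real.rpow_le_rpow_of_exponent_ge hδ0 hδ1 (by push_cast; linarith)
        have h2 : δ ^ (α - 1) * δ ^ 2 ≤ δ ^ α := by
          rw [← Real.rpow_natCast, ← Real.rpow_add hδ0]
          exact Real.rpow_le_rpow_of_exponent_ge hδ0 hδ1 (by push_cast; linarith)
        have h3 : (1 + (s + K) + K * δ ^ (α - 1)) * δ ^ 2 ≤ (1 + s + 2 * K) * δ ^ α := by
          have h4 := mul_le_mul_of_nonneg_left h1 (show 0 ≤ 1 + s + K by positivity)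
          have h5 := mul_le_mul_of_nonneg_left h2 hK
          linarith
        have h6 := mul_le_mul_of_nonneg_left h3 hC.le
        have h7 : 0 ≤ (1 + s) * δ ^ α := by positivity
        have h8 : 0 ≤ C * ((1 + s) * δ ^ α) := by positivity
        linarith

end ExpandingOnAverage

end RandomCircle

/-! ### The Markov chain and decay of correlations -/

namespace RandomCircle

open Filter Topology Set

universe u

variable {Ω : Type u} [MeasurableSpace Ω] {η : Measure Ω} {T : Ω → UnitAddCircle → UnitAddCircle}

/-- Prepend an element to a sequence. -/
def consSeq {X : Type*} (p : X × (ℕ → X)) : ℕ → X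
  | 0 => p.1
  | n + 1 => p.2 n

theorem measurable_consSeq : Measurable (consSeq : Ω × (ℕ → Ω) → ℕ → Ω) := by
  refine measurable_pi_lambda _ fun n => ?_
  cases n with
  | zero => exact measurable_fst
  | succ n => exact (measurable_pi_apply n).comp measurable_snd

/-- The infinite product measure is invariant under prepending an independent entry. -/
theorem map_consSeq [IsProbabilityMeasure η] :
    (η.prod (Measure.infinitePi fun _ : ℕ => η)).map consSeq =
      Measure.infinitePi fun _ : ℕ => η := by
  classical
  refine Measure.eq_infinitePi _ fun s t ht => ?_
  have hinj : InjOn Nat.succ (Nat.succ ⁻¹' (s : Set ℕ)) := Nat.succ_injective.injOn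
  have hpre : consSeq ⁻¹' ((s : Set ℕ).pi t) = (if 0 ∈ s then t 0 else univ) ×ˢ
      ((s.preimage Nat.succ hinj : Finset ℕ) : Set ℕ).pi fun i => t (i + 1) := by
    ext ⟨a, ω⟩
    simp only [mem_preimage, Set.mem_pi, mem_prod, Finset.mem_coe, Finset.mem_preimage]
    constructor
    · intro hx
      refine ⟨?_, fun i hi => hx (i + 1) hi⟩
      split_ifs with h0
      · exact hx 0 h0
      · exact mem_univ _
    · rintro ⟨h0, h1⟩ i hi
      cases i with
      | zero => rwa [if_pos hi] at h0
      | succ i => exact h1 i hi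
  rw [Measure.map_apply measurable_consSeq
    (MeasurableSet.pi s.countable_toSet fun i _ => ht i), hpre, Measure.prod_prod,
    Measure.infinitePi_pi _ fun i _ => ht (i + 1)]
  have h1 := Finset.prod_preimage' Nat.succ s hinj fun i => η (t i)
  have h2 : s.filter (· ∈ range Nat.succ) = s.erase 0 := by
    ext i
    simp only [Finset.mem_filter, Finset.mem_erase, and_comm, Nat.range_succ, mem_ofPred_eq,
      Nat.pos_iff_ne_zero]
  simp only [Nat.succ_eq_add_one] at h1 h2 ⊢
  rw [h1, h2]
  split_ifs with h0
  · exact Finset.mul_prod_erase s (fun i => η (t i)) h0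
  · rw [Finset.erase_eq_of_notMem h0, measure_univ, one_mul]

omit [MeasurableSpace Ω] in
theorem chain_consSeq (a : Ω) (ω : ℕ → Ω) (n : ℕ) (x : UnitAddCircle) :
    chain T (n + 1) (consSeq (a, ω)) x = chain T n ω (T a x) := by
  induction n with
  | zero => rfl
  | succ n ih =>
    rw [chain, ih]
    rfl

theorem measurable_chain (hm : Measurable fun p : Ω × UnitAddCircle => T p.1 p.2) (n : ℕ) :
    Measurable fun p : (ℕ → Ω) × UnitAddCircle => chain T n p.1 p.2 := by
  induction n with
  | zero => exact measurable_snd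
  | succ n ih => exact hm.comp (((measurable_pi_apply n).comp measurable_fst).prodMk ih)

/-- The expectation of `∏_{j < N} u_j (X_j)` for the chain started at `x`. -/
noncomputable def expectProd (η : Measure Ω) [IsProbabilityMeasure η]
    (T : Ω → UnitAddCircle → UnitAddCircle) (u : ℕ → UnitAddCircle → ℂ) (N : ℕ)
    (x : UnitAddCircle) : ℂ :=
  ∫ ω, ∏ j ∈ Finset.range N, u j (chain T j ω x) ∂(Measure.infinitePi fun _ : ℕ => η)

section ExpectProd

variable [IsProbabilityMeasure η] {u : ℕ → UnitAddCircle → ℂ}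

omit [MeasurableSpace Ω] in
theorem norm_prod_chain_le (hu1 : ∀ j x, ‖u j x‖ ≤ 1) (N : ℕ) (ω : ℕ → Ω) (x : UnitAddCircle) :
    ‖∏ j ∈ Finset.range N, u j (chain T j ω x)‖ ≤ 1 := by
  rw [norm_prod]
  exact Finset.prod_le_one (fun _ _ => norm_nonneg _) fun j _ => hu1 j _

theorem stronglyMeasurable_prod_chain
    (hm : Measurable fun p : Ω × UnitAddCircle => T p.1 p.2) (hu : ∀ j, Measurable (u j)) (N : ℕ) :
    StronglyMeasurable fun p : (ℕ → Ω) × UnitAddCircle =>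
      ∏ j ∈ Finset.range N, u j (chain T j p.1 p.2) :=
  (Finset.measurable_fun_prod _ fun j _ =>
    (hu j).comp (measurable_chain hm j)).stronglyMeasurable

theorem norm_expectProd_le (hu1 : ∀ j x, ‖u j x‖ ≤ 1) (N : ℕ) (x : UnitAddCircle) :
    ‖expectProd η T u N x‖ ≤ 1 := by
  have h1 := norm_integral_le_of_norm_le_const (μ := Measure.infinitePi fun _ : ℕ => η)
    (Eventually.of_forall fun ω => norm_prod_chain_le (T := T) hu1 N ω x)
  simpa [expectProd] using h1

theorem measurable_expectProd (hm : Measurable fun p : Ω × UnitAddCircle => T p.1 p.2)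
    (hu : ∀ j, Measurable (u j)) (N : ℕ) : Measurable (expectProd η T u N) :=
  ((stronglyMeasurable_prod_chain hm hu N).comp_measurable
    measurable_swap).integral_prod_right'.measurable

/-- The Markov property at time one: the first noise variable is split off, and the remaining
sequence has the same law. -/
theorem expectProd_succ (hm : Measurable fun p : Ω × UnitAddCircle => T p.1 p.2)
    (hu : ∀ j, Measurable (u j)) (hu1 : ∀ j x, ‖u j x‖ ≤ 1) (N : ℕ) (x : UnitAddCircle) :
    expectProd η T u (N + 1) x
      = u 0 x * ∫ a, expectProd η T (fun j => u (j + 1)) N (T a x) ∂η := by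
  have hmx : Measurable fun a => T a x := hm.comp (measurable_id.prodMk measurable_const)
  have hmeas := fun N => stronglyMeasurable_prod_chain hm hu N
  rw [expectProd]
  nth_rw 1 [← map_consSeq]
  rw [integral_map (f := fun ω => ∏ j ∈ Finset.range (N + 1), u j (chain T j ω x))
    measurable_consSeq.aemeasurable ((hmeas (N + 1)).comp_measurable
    (measurable_id.prodMk measurable_const)).aestronglyMeasurable]
  have h1 : ∀ p : Ω × (ℕ → Ω), ∏ j ∈ Finset.range (N + 1), u j (chain T j (consSeq p) x)
      = u 0 x * ∏ j ∈ Finset.range N, u (j + 1) (chain T j p.2 (T p.1 x)) := by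
    rintro ⟨a, ω⟩
    rw [Finset.prod_range_succ', mul_comm]
    congr 1
    exact Finset.prod_congr rfl fun j _ => by rw [chain_consSeq]
  simp_rw [h1, integral_const_mul]
  congr 1
  rw [integral_prod]
  · rfl
  · refine Integrable.of_bound ?_ 1 (Eventually.of_forall fun p =>
      norm_prod_chain_le (u := fun j => u (j + 1)) (fun j => hu1 _) N p.2 (T p.1 x))
    exact ((stronglyMeasurable_prod_chain (u := fun j => u (j + 1)) hm
      (fun j => hu _) N).comp_measurable
      (measurable_snd.prodMk (hmx.comp measurable_fst))).aestronglyMeasurable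

end ExpectProd

theorem weightedEvolution_congr {u w : ℕ → UnitAddCircle → ℂ} (f : UnitAddCircle → ℂ) {n : ℕ}
    (huw : ∀ j < n, u j = w j) : weightedEvolution η T u f n = weightedEvolution η T w f n := by
  induction n with
  | zero => rfl
  | succ n ih =>
    rw [weightedEvolution, weightedEvolution, ih fun j hj => huw j (by omega), huw n (by omega)]

theorem weightedEvolution_add_of_one {u : ℕ → UnitAddCircle → ℂ} (f : UnitAddCircle → ℂ)
    (m n : ℕ) (hu : ∀ j, m ≤ j → j < m + n → u j = fun _ => 1) :
    weightedEvolution η T u f (m + n) = (avgTransfer η T)^[n] (weightedEvolution η T u f m) := by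
  induction n with
  | zero => rfl
  | succ n ih =>
    rw [← add_assoc, weightedEvolution, ih fun j h1 h2 => hu j h1 (by omega),
      hu (m + n) (by omega) (by omega), Function.iterate_succ_apply']
    simp

/-- Integration against a measure on the circle with continuous nonnegative density. -/
theorem integral_withDensity_ofReal {φ : UnitAddCircle → ℝ} (hφ : Continuous φ)
    (hφ0 : ∀ x, 0 ≤ φ x) {𝕜 : Type*} [RCLike 𝕜] (f : UnitAddCircle → 𝕜) :
    ∫ x, f x ∂((volume : Measure UnitAddCircle).withDensity fun x => ENNReal.ofReal (φ x))
      = ∫ x, f x * (φ x : 𝕜) := by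
  rw [integral_withDensity_eq_integral_toReal_smul hφ.measurable.ennreal_ofReal
    (Eventually.of_forall fun _ => ENNReal.ofReal_lt_top)]
  congr 1
  funext x
  rw [ENNReal.toReal_ofReal (hφ0 x), RCLike.real_smul_eq_coe_mul, mul_comm]

theorem expect_prod_chain [IsProbabilityMeasure η] {u : ℕ → UnitAddCircle → ℂ}
    (hm : Measurable fun p : Ω × UnitAddCircle => T p.1 p.2)
    (hu : ∀ j, Measurable (u j)) (hu1 : ∀ j x, ‖u j x‖ ≤ 1) {φ : UnitAddCircle → ℝ}
    (hφ : Continuous φ) (hφ0 : ∀ x, 0 ≤ φ x) {μ : Measure UnitAddCircle} [IsProbabilityMeasure μ]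
    (hμ : μ = (volume : Measure UnitAddCircle).withDensity fun x => ENNReal.ofReal (φ x))
    (N : ℕ) :
    expect η μ (fun ω x => ∏ j ∈ Finset.range N, u j (chain T j ω x))
      = ∫ x, expectProd η T u N x * (φ x : ℂ) := by
  rw [expect, integral_prod_symm]
  · have h1 := integral_withDensity_ofReal hφ hφ0 (expectProd η T u N)
    rw [← hμ] at h1
    exact h1
  · exact Integrable.of_bound (stronglyMeasurable_prod_chain hm hu N).aestronglyMeasurable 1
      (Eventually.of_forall fun p => norm_prod_chain_le hu1 N p.1 p.2)

omit [MeasurableSpace Ω] in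
theorem initialBlock_eq (g : ℕ → UnitAddCircle → ℂ) (m : ℕ) (ω : ℕ → Ω) (x : UnitAddCircle) :
    initialBlock T g m ω x = ∏ j ∈ Finset.range (m + 1), g j (chain T j ω x) := by
  rw [initialBlock, Nat.range_succ_eq_Icc_zero]

omit [MeasurableSpace Ω] in
theorem laterBlock_eq (g : ℕ → UnitAddCircle → ℂ) (m k n : ℕ) (ω : ℕ → Ω) (x : UnitAddCircle) :
    laterBlock T g m k n ω x =
      ∏ i ∈ Finset.range k, g (m + 1 + i) (chain T (m + 1 + n + i) ω x) := by
  have h1 : Finset.Icc (m + 1) (m + k) = Finset.Ico (m + 1) (m + 1 + k) := by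
    ext i
    simp only [Finset.mem_Icc, Finset.mem_Ico]
    omega
  rw [laterBlock, h1, Finset.prod_Ico_eq_prod_range, Nat.add_sub_cancel_left]
  exact Finset.prod_congr rfl fun i _ => by rw [add_right_comm (m + 1) i n]

/-- The sequence of observables which starts with `u` up to time `m`, pauses for `n` steps, and
continues with `g`. -/
def gapSeq (u g : ℕ → UnitAddCircle → ℂ) (m n j : ℕ) : UnitAddCircle → ℂ :=
  if j < m + 1 then u j else if j < m + 1 + n then fun _ => 1 else g (j - n)

omit [MeasurableSpace Ω] in
theorem prod_gapSeq (u g : ℕ → UnitAddCircle → ℂ) (m k n : ℕ) (ω : ℕ → Ω) (x : UnitAddCircle) :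
    ∏ j ∈ Finset.range (m + 1 + n + k), gapSeq u g m n j (chain T j ω x) =
      initialBlock T u m ω x * laterBlock T g m k n ω x := by
  rw [initialBlock_eq, laterBlock_eq, Finset.prod_range_add, Finset.prod_range_add]
  congr 1
  · have h1 : ∏ i ∈ Finset.range n,
        gapSeq u g m n (m + 1 + i) (chain T (m + 1 + i) ω x) = 1 := by
      refine Finset.prod_eq_one fun i hi => ?_
      have hi' := Finset.mem_range.1 hi
      rw [gapSeq, if_neg (by omega), if_pos (by omega)]
    rw [h1, mul_one]
    refine Finset.prod_congr rfl fun j hj => ?_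
    rw [gapSeq, if_pos (Finset.mem_range.1 hj)]
  · refine Finset.prod_congr rfl fun i _ => ?_
    rw [gapSeq, if_neg (by omega), if_neg (by omega)]
    congr 1
    omega

theorem gapSeq_add (u g : ℕ → UnitAddCircle → ℂ) (m n j : ℕ) :
    gapSeq u g m n (j + (m + 1 + n)) = g (j + (m + 1)) := by
  rw [gapSeq, if_neg (by omega), if_neg (by omega)]
  congr 1
  omega

theorem norm_phase (f : ℕ → UnitAddCircle → ℝ) (t : ℕ → ℝ) (k : ℕ) (x : UnitAddCircle) :
    ‖phase f t k x‖ = 1 := by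
  have h1 := Complex.norm_exp_I_mul_ofReal (t k * f k x)
  rw [phase, mul_assoc]
  exact_mod_cast h1

/-- From `|e^(is) - 1| ≤ |s|`. The Hölder constant `ε * H` is uniform in the index. -/
theorem norm_phase_sub_le {f : ℕ → UnitAddCircle → ℝ} {t : ℕ → ℝ} {α H ε : ℝ}
    (hε : 0 ≤ ε) (hf : ∀ k x y, |f k x - f k y| ≤ H * dist x y ^ α) (ht : ∀ k, |t k| ≤ ε)
    (k : ℕ) (x y : UnitAddCircle) :
    ‖phase f t k x - phase f t k y‖ ≤ ε * H * dist x y ^ α := by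
  have h1 : phase f t k x - phase f t k y
      = phase f t k y * (Complex.exp (Complex.I * (t k * (f k x - f k y) : ℝ)) - 1) := by
    rw [mul_sub, mul_one, phase, phase, ← Complex.exp_add]
    congr 2
    push_cast
    ring
  rw [h1, norm_mul, norm_phase, one_mul]
  refine (Real.norm_exp_I_mul_ofReal_sub_one_le).trans ?_
  rw [Real.norm_eq_abs, abs_mul, mul_assoc]
  exact mul_le_mul (ht k) (hf k x y) (abs_nonneg _) hε

namespace ExpandingOnAverage

variable (h : ExpandingOnAverage η T) [IsProbabilityMeasure η]

include h

theorem continuous_weightedEvolution {u : ℕ → UnitAddCircle → ℂ} (hu : ∀ j, Continuous (u j))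
    {f : UnitAddCircle → ℂ} (hf : Continuous f) (n : ℕ) :
    Continuous (weightedEvolution η T u f n) := by
  induction n with
  | zero => exact hf
  | succ n ih => exact h.continuous_avgTransfer ((hu n).mul ih)

/-- Duality, one step at a time: the factor `u n` and one Markov step move from the observable to
the density. -/
theorem integral_expectProd_mul {u : ℕ → UnitAddCircle → ℂ} (hu : ∀ j, Continuous (u j))
    (hu1 : ∀ j x, ‖u j x‖ ≤ 1) {f : UnitAddCircle → ℂ} (hf : Continuous f) (n N : ℕ) :
    ∫ x, expectProd η T u (n + N) x * f x =
      ∫ x, expectProd η T (fun j => u (j + n)) N x * weightedEvolution η T u f n x := by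
  induction n generalizing N with
  | zero => simp [weightedEvolution]
  | succ n ih =>
    have hev := h.continuous_weightedEvolution hu hf n
    have hm := fun j => (hu j).measurable
    rw [add_assoc, add_comm 1 N, ih (N + 1)]
    have h1 := h.integral_mul_avgTransfer (ψ := expectProd η T (fun j => u (j + (n + 1))) N)
      (f := fun x => u n x * weightedEvolution η T u f n x)
      (measurable_expectProd h.measurable (fun j => hm _) N)
      (norm_expectProd_le (fun j => hu1 _) N) ((hu n).mul hev)
    rw [weightedEvolution, h1]
    congr 1
    funext x
    rw [expectProd_succ h.measurable (fun j => hm _) (fun j => hu1 _)]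
    simp only [zero_add, add_right_comm _ 1 n, add_assoc _ n 1]
    ring

/-- The regular stationary measure obtained from an invariant density. -/
theorem isRegularStationary_of_invariant {φ : UnitAddCircle → ℝ} {L c : ℝ} (hL : 0 ≤ L)
    (hc : 0 < c) (hφL : ∀ u v, |φ u - φ v| ≤ L * dist u v) (hφc : ∀ x, c ≤ φ x)
    (hφ1 : ∫ x, φ x = 1) (hφ : avgTransfer η T φ = φ) :
    IsRegularStationary η T
      ((volume : Measure UnitAddCircle).withDensity fun x => ENNReal.ofReal (φ x)) := by
  have hlip : LipschitzWith ⟨L, hL⟩ φ := LipschitzWith.of_dist_le_mul hφL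
  have hφ0 : ∀ x, 0 ≤ φ x := fun x => hc.le.trans (hφc x)
  refine ⟨⟨?_⟩, fun f hf ⟨B, hB⟩ => ?_, φ, ⟨_, hlip⟩, ⟨c, hc, hφc⟩, rfl⟩
  · rw [withDensity_apply _ MeasurableSet.univ, Measure.restrict_univ,
      ← ofReal_integral_eq_lintegral_ofReal (integrable_of_continuous hlip.continuous)
        (Eventually.of_forall hφ0), hφ1, ENNReal.ofReal_one]
  · rw [integral_withDensity_ofReal hlip.continuous hφ0,
      integral_withDensity_ofReal hlip.continuous hφ0]
    have h1 := h.integral_mul_avgTransfer hf hB hlip.continuous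
    rw [hφ] at h1
    exact h1.symm

/-- The density of a regular stationary measure is a fixed point of the averaged transfer
operator. -/
theorem avgTransfer_eq_of_isStationary {φ : UnitAddCircle → ℝ} (hφ : Continuous φ)
    (hφ0 : ∀ x, 0 ≤ φ x)
    (hst : IsStationary η T
      ((volume : Measure UnitAddCircle).withDensity fun x => ENNReal.ofReal (φ x))) :
    avgTransfer η T φ = φ := by
  have hPc := h.continuous_avgTransfer hφ
  -- Stationarity is tested against the defect itself, which gives `∫ ψ² = 0`; continuity upgrades
  -- this to vanishing everywhere.
  set ψ : UnitAddCircle → ℝ := fun x => avgTransfer η T φ x - φ x with hψ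
  have hψc : Continuous ψ := hPc.sub hφ
  obtain ⟨B, -, hB⟩ := exists_norm_le_of_continuous hψc
  have h1 := hst ψ hψc.measurable ⟨B, hB⟩
  rw [integral_withDensity_ofReal hφ hφ0, integral_withDensity_ofReal hφ hφ0] at h1
  have h2 : ∫ x, ψ x * avgTransfer η T φ x = ∫ x, ψ x * φ x :=
    (h.integral_mul_avgTransfer hψc.measurable hB hφ).trans h1
  have h3 : ∫ x, ψ x ^ 2 = 0 := by
    have hi1 : Integrable fun x => ψ x * avgTransfer η T φ x :=
      integrable_of_continuous (hψc.mul hPc)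
    have hi2 : Integrable fun x => ψ x * φ x := integrable_of_continuous (hψc.mul hφ)
    rw [← sub_eq_zero, ← integral_sub hi1 hi2] at h2
    rw [← h2]
    congr 1
    funext x
    simp only [hψ]
    ring
  have h4 : (fun x => ψ x ^ 2) =ᵐ[volume] 0 :=
    (integral_eq_zero_iff_of_nonneg (fun x => sq_nonneg _)
      (integrable_of_continuous (hψc.pow 2))).1 h3
  have h5 := (Continuous.ae_eq_iff_eq volume (hψc.pow 2) continuous_const).1 h4
  funext x
  have h6 : ψ x ^ 2 = 0 := congrFun h5 x
  exact sub_eq_zero.1 (pow_eq_zero_iff two_ne_zero |>.1 h6)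

/-- Exponential convergence to the invariant density for complex Hölder initial data. -/
theorem exists_decay_complex {φ : UnitAddCircle → ℝ} {L c : ℝ} (hL : 0 ≤ L) (hc : 0 < c)
    (hφL : ∀ u v, |φ u - φ v| ≤ L * dist u v) (hφc : ∀ x, c ≤ φ x) (hφ1 : ∫ x, φ x = 1)
    (hφ : avgTransfer η T φ = φ) :
    ∃ θ C : ℝ, 0 < θ ∧ θ < 1 ∧ 0 < C ∧ ∀ (α : ℝ), 0 < α → α < 1 →
      ∀ (f : UnitAddCircle → ℂ) (s K : ℝ), 0 ≤ K →
      (∀ x, ‖f x‖ ≤ s) → (∀ u v, ‖f u - f v‖ ≤ K * dist u v ^ α) → ∀ n : ℕ,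
      ∫ x, ‖(avgTransfer η T)^[n] f x - (∫ y, f y) * (φ x : ℂ)‖
        ≤ C * (1 + s + K) * θ ^ (α * (n : ℝ)) := by
  obtain ⟨θ, C, hθ0, hθ1, hC, hdec⟩ := h.exists_decay_holder hL hc hφL hφc hφ1 hφ
  refine ⟨θ, 2 * C, hθ0, hθ1, by positivity, fun α hα hα1 f s K hK hfs hfK n => ?_⟩
  have hφcont : Continuous φ := continuous_of_dist_le_rpow (α := 1) (K := L) one_pos fun u v => by
    rw [Real.rpow_one]; exact hφL u v
  have hfc : Continuous f := continuous_of_dist_le_rpow hα fun u v => by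
    rw [dist_eq_norm]; exact hfK u v
  have hfi := integrable_of_continuous hfc
  have hfn := h.continuous_iterate hfc n
  -- Applied to the real and imaginary parts, both of which commute with the averaged operator.
  have key : ∀ l : ℂ →L[ℝ] ℝ, (∀ z, |l z| ≤ ‖z‖) →
      ∫ x, |(avgTransfer η T)^[n] (fun y => l (f y)) x - (∫ y, l (f y)) * φ x|
        ≤ C * (1 + s + K) * θ ^ (α * (n : ℝ)) := by
    intro l hl
    refine hdec α hα hα1 _ s K hK (fun x => (hl _).trans (hfs x)) (fun u v => ?_) n
    rw [← map_sub]
    exact (hl _).trans (hfK u v)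
  have hre := key Complex.reCLM Complex.abs_re_le_norm
  have him := key Complex.imCLM Complex.abs_im_le_norm
  rw [h.iterate_clm hfc, ContinuousLinearMap.integral_comp_comm _ hfi] at hre him
  simp only [Complex.reCLM_apply, Complex.imCLM_apply] at hre him
  have hi1 : Integrable fun x => |((avgTransfer η T)^[n] f x).re - (∫ y, f y).re * φ x| :=
    integrable_of_continuous
      ((Complex.continuous_re.comp hfn).sub (continuous_const.mul hφcont)).abs
  have hi2 : Integrable fun x => |((avgTransfer η T)^[n] f x).im - (∫ y, f y).im * φ x| :=
    integrable_of_continuous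
      ((Complex.continuous_im.comp hfn).sub (continuous_const.mul hφcont)).abs
  have hle := integral_mono (integrable_of_continuous
    (hfn.sub (continuous_const.mul (Complex.continuous_ofReal.comp hφcont))).norm)
    (hi1.add hi2) (fun x => (by
      refine (Complex.norm_le_abs_re_add_abs_im _).trans_eq ?_
      simp :
      ‖(avgTransfer η T)^[n] f x - (∫ y, f y) * (φ x : ℂ)‖ ≤
        |((avgTransfer η T)^[n] f x).re - (∫ y, f y).re * φ x|
          + |((avgTransfer η T)^[n] f x).im - (∫ y, f y).im * φ x|))
  refine hle.trans ?_
  simp only [Pi.add_apply]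
  rw [integral_add hi1 hi2]
  linarith

/-- Uniform decay of correlations of products of Hölder phases. -/
theorem exists_correlation_decay {φ : UnitAddCircle → ℝ} {L c : ℝ} (hL : 0 ≤ L) (hc : 0 < c)
    (hφL : ∀ u v, |φ u - φ v| ≤ L * dist u v) (hφc : ∀ x, c ≤ φ x)
    (hφ : avgTransfer η T φ = φ) {μ : Measure UnitAddCircle} [IsProbabilityMeasure μ]
    (hμ : μ = (volume : Measure UnitAddCircle).withDensity fun x => ENNReal.ofReal (φ x)) :
    ∃ θ : ℝ, 0 < θ ∧ θ < 1 ∧ ∀ α K : ℝ, 0 < α → α < 1 → 0 ≤ K → ∃ C : ℝ, 0 < C ∧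
      ∀ g : ℕ → UnitAddCircle → ℂ, (∀ j x, ‖g j x‖ ≤ 1) →
      (∀ j x y, ‖g j x - g j y‖ ≤ K * dist x y ^ α) → ∀ m k n : ℕ,
      ‖expect η μ (fun ω x => initialBlock T g m ω x * laterBlock T g m k n ω x) -
        expect η μ (initialBlock T g m) * expect η μ (laterBlock T g m k n)‖
        ≤ C * θ ^ (α * (n : ℝ)) := by
  have hφ0 : ∀ x, 0 ≤ φ x := fun x => hc.le.trans (hφc x)
  have hφlog : LogLip (L / c) φ := logLip_of_abs_sub_le hL hc hφc hφL
  have hb : 0 ≤ L / c := by positivity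
  have hφcont : Continuous φ := hφlog.continuous hb hφ0
  have hφ1 : ∫ x, φ x = 1 := by
    have h1 := integral_withDensity_ofReal (𝕜 := ℝ) hφcont hφ0 fun _ => 1
    rw [← hμ] at h1
    simpa using h1.symm
  have hφC : Continuous fun x => (φ x : ℂ) := Complex.continuous_ofReal.comp hφcont
  have hφn : ∀ n, (avgTransfer η T)^[n] φ = φ := fun n => Function.iterate_fixed hφ n
  have hφCn : ∀ n, (avgTransfer η T)^[n] (fun x => (φ x : ℂ)) = fun x => (φ x : ℂ) := fun n => by
    have h1 := h.iterate_clm hφcont Complex.ofRealCLM n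
    rw [hφn] at h1
    exact h1
  obtain ⟨θ, C, hθ0, hθ1, hC, hdec⟩ := h.exists_decay_complex hL hc hφL hφc hφ1 hφ
  refine ⟨θ, hθ0, hθ1, fun α K hα hα1 hK => ?_⟩
  obtain ⟨q, C₁, hq0, hq1, hC₁, hmix⟩ := h.exists_mixture_weightedEvolution hα hα1.le hK
  -- Bounds the second moments after any number of steps, hence uniformly in `m`.
  set A : ℝ := (L / c) ^ 2 + C₁ with hA
  have hA0 : 0 ≤ A := by positivity
  refine ⟨C * (1 + (3 + A) + (2 + 4 * A + 2 * A)), by positivity,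
    fun g hg1 hgK m k n => ?_⟩
  have hgc : ∀ j, Continuous (g j) := fun j => continuous_of_dist_le_rpow hα fun u v => by
    rw [dist_eq_norm]; exact hgK j u v
  -- The evolution starts from `φ` in both roles. The lower bound `c` makes its Lipschitz bound a
  -- relative Hölder bound with constant `L / c`.
  have M0 : Mixture.{u} α ((L / c) ^ 2) ((L / c) ^ 2) (fun x => (φ x : ℂ)) φ := by
    refine Mixture.single hb hb hφC (fun x => ?_) (fun u v => ?_) hφlog hφ1
    · rw [Complex.norm_real, Real.norm_of_nonneg (hφ0 x)]
    · rw [← Complex.ofReal_sub, Complex.norm_real, Real.norm_eq_abs]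
      have hd : dist u v ≤ dist u v ^ α := by
        rcases (dist_nonneg (x := u) (y := v)).eq_or_lt with h0 | h0
        · rw [← h0]
          exact Real.rpow_nonneg le_rfl _
        · simpa using Real.rpow_le_rpow_of_exponent_ge h0 (by linarith [dist_le_half u v]) hα1.le
      calc |φ u - φ v| ≤ L / c * dist u v * c := by
            refine (hφL u v).trans_eq ?_
            field_simp
        _ ≤ L / c * dist u v ^ α * (φ u + φ v) := by
            gcongr
            linarith [hφc u, hφ0 v]
  -- The `m + 1` steps include the transition out of time `m`; exactly `n` free transitions remain
  -- before the later block starts at time `m + 1 + n`.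
  obtain ⟨M⟩ := hmix _ _ _ g _ hg1 hgK M0 (m + 1)
  have hqA : q ^ (m + 1) * (L / c) ^ 2 + C₁ ≤ A := by
    rw [hA]
    gcongr
    exact mul_le_of_le_one_left (by positivity) (pow_le_one₀ hq0 hq1.le)
  have M' := M.mono hqA hqA
  rw [hφn] at M'
  set f := weightedEvolution η T g (fun x => (φ x : ℂ)) (m + 1) with hf
  have hfc : Continuous f := h.continuous_weightedEvolution hgc hφC _
  have hfdec := hdec α hα hα1 f (3 + A) (2 + 4 * A + 2 * A) (by positivity)
    (fun x => (M'.norm_f_le x).trans (M'.φ_le x)) M'.norm_f_sub_le n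
  have hone1 : ∀ (j : ℕ) (x : UnitAddCircle), ‖(fun (_ : ℕ) (_ : UnitAddCircle) => (1 : ℂ)) j x‖
      ≤ 1 := by simp
  have honec : ∀ j : ℕ, Continuous ((fun (_ : ℕ) (_ : UnitAddCircle) => (1 : ℂ)) j) :=
    fun j => continuous_const
  have hgap1 : ∀ u : ℕ → UnitAddCircle → ℂ, (∀ j x, ‖u j x‖ ≤ 1) →
      ∀ j x, ‖gapSeq u g m n j x‖ ≤ 1 := by
    intro u hu j x
    rw [gapSeq]
    split_ifs
    · exact hu j x
    · simp
    · exact hg1 _ x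
  have hgapc : ∀ u : ℕ → UnitAddCircle → ℂ, (∀ j, Continuous (u j)) →
      ∀ j, Continuous (gapSeq u g m n j) := by
    intro u hu j
    rw [gapSeq]
    split_ifs
    · exact hu j
    · exact continuous_const
    · exact hgc _
  set Ψ := expectProd η T (fun j => g (j + (m + 1))) k with hΨ
  -- The first block is left general: `u = g` gives the joint expectation and `u = 1` that of the
  -- later block alone.
  have hblock : ∀ u : ℕ → UnitAddCircle → ℂ, (∀ j x, ‖u j x‖ ≤ 1) → (∀ j, Continuous (u j)) →
      expect η μ (fun ω x => initialBlock T u m ω x * laterBlock T g m k n ω x) =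
        ∫ x, Ψ x * (avgTransfer η T)^[n]
          (weightedEvolution η T u (fun x => (φ x : ℂ)) (m + 1)) x := by
    intro u hu1 huc
    simp_rw [← prod_gapSeq]
    rw [expect_prod_chain h.measurable (fun j => (hgapc u huc j).measurable) (hgap1 u hu1)
      hφcont hφ0 hμ, h.integral_expectProd_mul (hgapc u huc) (hgap1 u hu1) hφC,
      weightedEvolution_add_of_one _ _ _ fun j h1 h2 => ?_,
      weightedEvolution_congr (w := u) _ fun j hj => ?_]
    · simp_rw [gapSeq_add, hΨ]
    · rw [gapSeq, if_pos hj]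
    · rw [gapSeq, if_neg (by omega), if_pos h2]
  have hFG := hblock g hg1 hgc
  have hG : expect η μ (laterBlock T g m k n) = ∫ x, Ψ x * (φ x : ℂ) := by
    have h1 := hblock _ hone1 honec
    have h2 := weightedEvolution_add_of_one (η := η) (T := T)
      (u := fun (_ : ℕ) (_ : UnitAddCircle) => (1 : ℂ)) (fun x => (φ x : ℂ)) 0 (m + 1)
      fun _ _ _ => rfl
    rw [zero_add] at h2
    rw [h2, ← Function.iterate_add_apply] at h1
    simp only [weightedEvolution, hφCn, initialBlock, Finset.prod_const_one, one_mul] at h1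
    exact h1
  have hF : expect η μ (initialBlock T g m) = ∫ x, f x := by
    have h1 := expect_prod_chain (η := η) h.measurable (fun j => (hgc j).measurable) hg1 hφcont hφ0 hμ
      (m + 1)
    have h2 := h.integral_expectProd_mul hgc hg1 hφC (m + 1) 0
    rw [add_zero] at h2
    rw [h2] at h1
    simp_rw [← initialBlock_eq] at h1
    refine h1.trans ?_
    simp [expectProd, hf]
  have hΨm : Measurable Ψ := measurable_expectProd h.measurable (fun j => (hgc _).measurable) k
  have hΨ1 : ∀ x, ‖Ψ x‖ ≤ 1 := norm_expectProd_le (fun j => hg1 _) k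
  have hΨi : ∀ w : UnitAddCircle → ℂ, Continuous w → Integrable fun x => Ψ x * w x := fun w hw =>
    (integrable_of_continuous hw).bdd_mul hΨm.aestronglyMeasurable (Eventually.of_forall hΨ1)
  have hfn := h.continuous_iterate hfc n
  have hfφ : Continuous fun x => (∫ y, f y) * (φ x : ℂ) := continuous_const.mul hφC
  -- Only `|Ψ| ≤ 1` is used about the later block, so the bound is uniform in `k`.
  have hdiff : expect η μ (fun ω x => initialBlock T g m ω x * laterBlock T g m k n ω x) -
      expect η μ (initialBlock T g m) * expect η μ (laterBlock T g m k n)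
      = ∫ x, Ψ x * ((avgTransfer η T)^[n] f x - (∫ y, f y) * (φ x : ℂ)) := by
    rw [hFG, hF, hG, ← integral_const_mul]
    simp_rw [mul_sub]
    rw [integral_sub (hΨi _ hfn) (hΨi _ hfφ)]
    congr 2
    funext x
    ring
  rw [hdiff]
  refine le_trans (norm_integral_le_of_norm_le
    (integrable_of_continuous (hfn.sub hfφ).norm) (Eventually.of_forall fun x => ?_)) hfdec
  rw [norm_mul]
  exact mul_le_of_le_one_left (norm_nonneg _) (hΨ1 x)

end ExpandingOnAverage

/-- The hypotheses in terms of lower integrals. -/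
theorem expandingOnAverage_of_lintegral [IsProbabilityMeasure η]
    (hm : Measurable fun p : Ω × UnitAddCircle => T p.1 p.2)
    (hT : ∀ ω, IsC2NonCritical (T ω))
    (hdil : ∫⁻ ω, ENNReal.ofReal ((dilation (T ω))⁻¹ ^ 2) ∂η < 1)
    (hdist : ∫⁻ ω, ENNReal.ofReal (distortion (T ω) ^ 2) ∂η < ⊤) :
    ExpandingOnAverage η T := by
  have h1 : AEStronglyMeasurable (fun ω => (dilation (T ω))⁻¹ ^ 2) η :=
    ((measurable_dilation hm hT).inv.pow_const 2).aestronglyMeasurable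
  have h2 : AEStronglyMeasurable (fun ω => distortion (T ω) ^ 2) η :=
    ((measurable_distortion hm hT).pow_const 2).aestronglyMeasurable
  refine ⟨hm, hT, ⟨h1, ?_⟩, ?_, ⟨h2, ?_⟩⟩
  · rw [hasFiniteIntegral_iff_ofReal (Eventually.of_forall fun ω => sq_nonneg _)]
    exact hdil.trans ENNReal.one_lt_top
  · rw [integral_eq_lintegral_of_nonneg_ae (Eventually.of_forall fun ω => sq_nonneg _) h1]
    exact (ENNReal.toReal_lt_toReal (hdil.trans ENNReal.one_lt_top).ne ENNReal.one_ne_top).2 hdil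
  · rwa [hasFiniteIntegral_iff_ofReal (Eventually.of_forall fun ω => sq_nonneg _)]

end RandomCircle

theorem mainTheorem5 {Ω : Type*} [MeasurableSpace Ω] (η : Measure Ω) [IsProbabilityMeasure η]
    (T : Ω → UnitAddCircle → UnitAddCircle)
    (hT_meas : Measurable (fun p : Ω × UnitAddCircle => T p.1 p.2))
    (hT_C2 : ∀ ω, IsC2NonCritical (T ω))
    (h_dilation : ∫⁻ ω, ENNReal.ofReal ((dilation (T ω))⁻¹ ^ 2) ∂η < 1)
    (h_distortion : ∫⁻ ω, ENNReal.ofReal (distortion (T ω) ^ 2) ∂η < ⊤) :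
    (∃ μ : Measure UnitAddCircle, IsRegularStationary η T μ) ∧
    ∀ μ : Measure UnitAddCircle, IsRegularStationary η T μ →
      ∃ θ : ℝ, 0 < θ ∧ θ < 1 ∧
        ∀ α H ε : ℝ, 0 < α → α < 1 → 0 < H → 0 < ε →
          ∃ C : ℝ, 0 < C ∧
            ∀ (f : ℕ → UnitAddCircle → ℝ) (t : ℕ → ℝ),
              (∀ k x y, |f k x - f k y| ≤ H * dist x y ^ α) →
              (∀ k, |t k| ≤ ε) →
              ∀ m k n : ℕ,
                ‖expect η μ (fun ω x => initialBlock T (phase f t) m ω x *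
                      laterBlock T (phase f t) m k n ω x) -
                    expect η μ (initialBlock T (phase f t) m) *
                      expect η μ (laterBlock T (phase f t) m k n)‖
                  ≤ C * θ ^ (α * (n : ℝ)) := by
  have h := expandingOnAverage_of_lintegral hT_meas hT_C2 h_dilation h_distortion
  refine ⟨?_, fun μ hμ => ?_⟩
  · obtain ⟨φ, ⟨L, hL, hφL⟩, ⟨c, hc, hφc⟩, hφ1, hφ⟩ := h.exists_invariant_density
    exact ⟨_, h.isRegularStationary_of_invariant hL hc hφL hφc hφ1 hφ⟩
  · obtain ⟨hprob, hst, φ, ⟨L, hφL⟩, ⟨c, hc, hφc⟩, hμφ⟩ := hμ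
    have hφ : avgTransfer η T φ = φ := h.avgTransfer_eq_of_isStationary hφL.continuous
      (fun x => hc.le.trans (hφc x)) (hμφ ▸ hst)
    obtain ⟨θ, hθ0, hθ1, hdec⟩ := h.exists_correlation_decay L.coe_nonneg hc
      (fun u v => hφL.dist_le_mul u v) hφc hφ hμφ
    refine ⟨θ, hθ0, hθ1, fun α H ε hα hα1 hH hε => ?_⟩
    -- The functions and frequencies enter only through the modulus one and the Hölder constant `ε *
    -- H` of the phases.
    obtain ⟨C, hC, hCdec⟩ := hdec α (ε * H) hα hα1 (by positivity)
    exact ⟨C, hC, fun f t hf ht => hCdec (phase f t) (fun j x => (norm_phase f t j x).le)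
      (norm_phase_sub_le hε.le hf ht)⟩
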